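/- Let $\mathcal{B}$ be the class of all finite simple graphs that are $2$-connected or consist of two distinct vertices joined by an edge. Let $\gamma$ be a weighting on $\mathcal{B}$, that is, an isomorphism-invariant assignment of a weight $\gamma(B)\in[0,\infty)$ to every $B\in\mathcal{B}$, and assume that $\gamma(B)>0$ for at least one $B\in\mathcal{B}$. To a connected graph $C$ assign the weight $\omega(C)=\prod_{B}\gamma(B)$, with $B$ ranging over the blocks of $C$ that have at least two vertices (so the one-vertex graph has weight $1$), and to an arbitrary finite graph $G$ the weight $\upsilon(G)$ given by the product of the $\omega$-weights of its connected components. For $n\ge 1$ let $\mathsf{G}_n^\upsilon$ be drawn from the set of all graphs with vertex set $[n]=\{1,\dots,n\}$ with probability proportional to $\upsilon$, and, whenever there is a connected graph with vertex set $[k]$ and positive $\omega$-weight, let $\mathsf{C}_k^\omega$ be drawn from the set of all connected graphs with vertex set $[k]$ with probability proportional to $\omega$. Then $\mathsf{G}_n^\upsilon$ is well defined for every $n\ge1$, and the following holds. (1) The number $K_n$ of vertices of the largest connected component of $\mathsf{G}_n^\upsilon$ satisfies $K_n=n+O_p(1)$ as $n\to\infty$. That is, for every $\varepsilon>0$ there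 is an $M$ with $\mathbb{P}(n-K_n>M)\le\varepsilon$ for all $n$. (2) Up to relabelling, the largest connected component of $\mathsf{G}_n^\upsilon$ is distributed like the randomly sized random connected graph $\mathsf{C}_{K_n}^\omega$. That is, let $n\ge1$ and let $L_n$ be a largest connected component of $\mathsf{G}_n^\upsilon$, where ties are broken by any rule that depends only on the partition of $[n]$ into the vertex sets of the components. Then for every $k$ and every graph $H$ with $k$ vertices $$\mathbb{P}(L_n\simeq H)=\mathbb{P}(K_n=k)\,\mathbb{P}(\mathsf{C}_k^\omega\simeq H),$$ where $\mathsf{C}_k^\omega$ is well defined whenever $\mathbb{P}(K_n=k)>0$, and the right-hand side is read as $0$ when $\mathbb{P}(K_n=k)=0$. -/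

import Mathlib

open scoped NNReal

namespace BlockWeighted

/-- No vertex of `G` is a cutvertex: removing any one vertex leaves no two vertices unconnected.
(For a graph with a single vertex the remaining graph is empty, which is not disconnected.) -/
def NoCutVertex {V : Type} (G : SimpleGraph V) : Prop :=
  ∀ v : V, (G.induce ({v}ᶜ : Set V)).Preconnected

/-- `2`-connected graphs: connected, at least three vertices, and removing any vertex does not
disconnect the graph. -/
def IsTwoConnected {V : Type} (G : SimpleGraph V) : Prop :=
  3 ≤ Nat.card V ∧ G.Connected ∧ NoCutVertex G

/-- The class `𝓑`: graphs that are `2`-connected or consist of two distinct vertices joined by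
an edge. -/
def IsBlockGraph {V : Type} (G : SimpleGraph V) : Prop :=
  IsTwoConnected G ∨ (Nat.card V = 2 ∧ G = ⊤)

/-- A weighting `γ` on the species `𝓑`: a nonnegative real weight for every graph in the class on
every finite vertex set, invariant under isomorphism. (Values at graphs that are infinite or
outside `𝓑` are never used.) -/
structure BlockWeighting where
  weight : (V : Type) → SimpleGraph V → ℝ≥0
  weight_iso : ∀ (V W : Type) [Finite V] [Finite W] (G : SimpleGraph V) (H : SimpleGraph W),
    IsBlockGraph G → Nonempty (G ≃g H) → weight V G = weight W H

/-- A block of `G`: a maximal connected subgraph that has no cutvertex of itself. -/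
def IsBlock {V : Type} (G : SimpleGraph V) (B : G.Subgraph) : Prop :=
  Maximal (fun H : G.Subgraph => H.Connected ∧ NoCutVertex H.coe) B

/-- `ω(C) = ∏_B γ(B)`, the product over the blocks `B` of `C` with at least two vertices. (A block
with only one vertex is an isolated vertex of `C`, is not a graph in `𝓑`, and contributes
nothing.) -/
noncomputable def connWeight (γ : BlockWeighting) {V : Type} (C : SimpleGraph V) : ℝ≥0 :=
  ∏ᶠ B ∈ {B : C.Subgraph | IsBlock C B ∧ B.verts.Nontrivial}, γ.weight B.verts B.coe

/-- `υ(G)`, the product of the `ω`-weights of the connected components of `G`. -/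
noncomputable def graphWeight (γ : BlockWeighting) {V : Type} (G : SimpleGraph V) : ℝ≥0 :=
  ∏ᶠ c : G.ConnectedComponent, connWeight γ c.toSimpleGraph

/-- The total weight of a finite set of objects. -/
noncomputable def inventory {α : Type} (w : α → ℝ≥0) : ℝ≥0 := ∑ᶠ a, w a

/-- The probability of the event `E` when an element of a finite set `α` is drawn with probability
proportional to its weight `w` (meaningful when the total weight is nonzero). -/
noncomputable def prob {α : Type} (w : α → ℝ≥0) (E : Set α) : ℝ :=
  ((inventory (E.indicator w) / inventory w : ℝ≥0) : ℝ)

/-- `𝓒[n]`, the set of connected graphs with vertex set `Fin n`. -/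
abbrev ConnGraph (n : ℕ) : Type := {C : SimpleGraph (Fin n) // C.Connected}

/-- The `ω`-weight on `𝓒[n]`. -/
noncomputable def connW (γ : BlockWeighting) (n : ℕ) (C : ConnGraph n) : ℝ≥0 :=
  connWeight γ C.1

/-- The `υ`-weight on `𝓖[n]`, the set of all graphs with vertex set `Fin n`. -/
noncomputable def graphW (γ : BlockWeighting) (n : ℕ) (G : SimpleGraph (Fin n)) : ℝ≥0 :=
  graphWeight γ G

/-- The number of vertices of a largest connected component. -/
noncomputable def largestComponentSize {V : Type} (G : SimpleGraph V) : ℕ :=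
  ⨆ c : G.ConnectedComponent, c.supp.ncard

/-- `L` selects in every graph on `Fin n` a largest connected component, where ties are broken in
a way that depends only on the partition of the vertices into connected components. -/
def SelectsLargestComponent {n : ℕ} (L : (G : SimpleGraph (Fin n)) → G.ConnectedComponent) :
    Prop :=
  (∀ G, (L G).supp.ncard = largestComponentSize G) ∧
    ∀ G H : SimpleGraph (Fin n), G.Reachable = H.Reachable → (L G).supp = (L H).supp

end BlockWeighted

/-!
Only the coefficients of the exponential generating series `C(z) = ∑ dₙ zⁿ` of the `ω`-weighted
connected graphs enter, where `dₙ` is `connCoeff γ n`. Write `B'(u)` for the series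
`blockSeries γ` of the block graphs rooted at an uncounted vertex.

*Formula for the coefficients.* All blocks of a graph on `V` are represented by graphs on `V`
(`IsPiece`, `blocks`), so that `υ(G)` is a product over `blocks G` (`graphWeight_eq_blockProd`).
Removing the edges of a block `β` of `G` leaves a graph in which the vertices of `β` lie in distinct
components, since a path between two of them would be an ear extending `β`. Conversely, a block
graph put on vertices in distinct components of `G` becomes a block, and the other blocks stay the
same, since the attaching vertices are cutvertices (`sum_blocks_eq`, `blocks_sup_piece`). Let
`F(k, q)` be the weight of the graphs with `k` components and `q` blocks, counted with the product
of their component sizes. Marking a block yields a linear recursion that expresses `F(k, q + 1)`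
through the `F(k + j, q)` (`rootedForestW_succ`), and its solution is explicit
(`rootedForestW_eq`). For `k = 1` it gives `n² dₙ = [uⁿ⁻¹] exp (n B'(u))` (`sq_mul_connCoeff`).

*Two inequalities.* Since `[uⁱ] exp (x B') [uʲ] exp (y B') ≤ [uⁱ⁺ʲ] exp ((x + y) B')`, the formula
yields `d_a d_b ≤ (12 / b²) d_{a+b-1}` for `b ≤ a` (`connCoeff_mul_le`): a fragment of size `b` may
be exchanged for an isolated vertex at the price of a factor that is summable in `b`. It also
yields `d_a ≤ C d_{a+m-1}` if there is a block graph with `m` vertices and positive weight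
(`exists_connCoeff_le`): isolated vertices may be absorbed in batches of `m - 1`.

*Tightness.* In a graph with largest component of size `k` and `j` other components of total size
`t`, all `j` fragments are exchanged for isolated vertices
(`connCoeff_mul_boundedForestCoeff_le`), which are then absorbed up to a bounded remainder
(`exists_connCoeff_sub_le`). Hence the probability that `t` vertices lie outside the largest
component is at most a constant times `∑ⱼ Cʲ [zᵗ] X(z)ʲ / j!` with `X(z) = ∑ (12 / b²) zᵇ`. This is
summable in `t` because `exp (C X(1))` is finite, and it does not depend on `n`. No growth or
regularity condition on the weights is needed.

*Law of the largest component.* A graph with a marked component is a connected graph on a subset `S`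
together with an arbitrary graph on the complement (`sum_compSets_eq`). Whether `S` gets selected
depends only on the partition into components, and so not on the connected graph on `S`. The
weights of the events in question therefore factorize (`sum_selected_eq`).
-/

namespace BlockWeighted

open SimpleGraph

/-! ### Reachability, closed sets and embeddings -/

/-- A vertex reachable from a set that is closed under adjacency belongs to it. -/
theorem mem_of_reachable {V : Type} {G : SimpleGraph V} {A : Set V}
    (hA : ∀ a ∈ A, ∀ b, G.Adj a b → b ∈ A) {x y : V} (h : G.Reachable x y) (hx : x ∈ A) :
    y ∈ A := by
  rw [reachable_iff_reflTransGen] at h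
  induction h with
  | refl => exact hx
  | tail _ hbc ih => exact hA _ ih _ hbc

theorem reachable_map_iff {V W : Type} (f : W ↪ V) (H : SimpleGraph W) (x y : W) :
    (H.map f).Reachable (f x) (f y) ↔ H.Reachable x y := by
  refine ⟨fun h => ?_, fun h => h.map (Embedding.map f H).toHom⟩
  have := mem_of_reachable (A := {v | ∀ z, f z = v → H.Reachable x z}) ?_ h ?_
  · exact this y rfl
  · rintro a ha b hab z rfl
    obtain ⟨u, v, huv, rfl, hv⟩ := (SimpleGraph.map_adj f H a (f z)).1 hab
    rw [f.injective hv] at huv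
    exact (ha u rfl).trans huv.reachable
  · intro z hz
    rw [f.injective hz]

theorem reachable_induce_iff {V : Type} (s : Set V) (H : SimpleGraph V) (x y : s) :
    (H.induce s).Reachable x y ↔ (H.induce s).spanningCoe.Reachable x y :=
  (reachable_map_iff (Function.Embedding.subtype s) _ x y).symm

theorem spanningCoe_induce_compl_singleton {V : Type} (H : SimpleGraph V) (v : V) :
    (H.induce ({v}ᶜ : Set V)).spanningCoe = H.deleteIncidenceSet v := by
  ext a b
  simp [deleteIncidenceSet_adj, SimpleGraph.map_adj]

theorem noCutVertex_iff {V : Type} (H : SimpleGraph V) :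
    NoCutVertex H ↔ ∀ v x y, x ≠ v → y ≠ v → (H.deleteIncidenceSet v).Reachable x y := by
  constructor
  · intro h v x y hx hy
    have := h v ⟨x, hx⟩ ⟨y, hy⟩
    rwa [reachable_induce_iff, spanningCoe_induce_compl_singleton] at this
  · rintro h v ⟨x, hx⟩ ⟨y, hy⟩
    rw [reachable_induce_iff, spanningCoe_induce_compl_singleton]
    exact h v x y hx hy

/-! ### Pieces: nontrivial connected graphs without cutvertex, up to isolated vertices -/

/-- A graph on `V` that, after discarding its isolated vertices, is connected, has no cutvertex
and has at least two vertices. Such graphs represent the subgraphs among which the blocks are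
the maximal ones, so that all of them live on the same vertex type. -/
def IsPiece {V : Type} (β : SimpleGraph V) : Prop :=
  β ≠ ⊥ ∧ (∀ x ∈ β.support, ∀ y ∈ β.support, β.Reachable x y) ∧
    ∀ v, ∀ x ∈ β.support, ∀ y ∈ β.support, x ≠ v → y ≠ v →
      (β.deleteIncidenceSet v).Reachable x y

theorem deleteIncidenceSet_map {V W : Type} (f : W ↪ V) (H : SimpleGraph W) (v : W) :
    (H.map f).deleteIncidenceSet (f v) = (H.deleteIncidenceSet v).map f := by
  ext a b
  simp only [deleteIncidenceSet_adj, SimpleGraph.map_adj]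
  constructor
  · rintro ⟨⟨x, y, h, rfl, rfl⟩, h1, h2⟩
    exact ⟨x, y, ⟨h, fun e => h1 (e ▸ rfl), fun e => h2 (e ▸ rfl)⟩, rfl, rfl⟩
  · rintro ⟨x, y, ⟨h, h1, h2⟩, rfl, rfl⟩
    exact ⟨⟨x, y, h, rfl, rfl⟩, fun e => h1 (f.injective e), fun e => h2 (f.injective e)⟩

theorem map_ne_bot_iff {V W : Type} (f : W ↪ V) (H : SimpleGraph W) : H.map f ≠ ⊥ ↔ H ≠ ⊥ := by
  rw [not_iff_not]
  constructor
  · intro h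
    exact SimpleGraph.map_injective f (by rw [h]; ext; simp [SimpleGraph.map_adj])
  · rintro rfl
    ext; simp [SimpleGraph.map_adj]

theorem isPiece_map_iff {V W : Type} (f : W ↪ V) (H : SimpleGraph W) :
    IsPiece (H.map f) ↔ IsPiece H := by
  unfold IsPiece
  rw [map_ne_bot_iff, support_map]
  refine and_congr_right fun _ => and_congr ?_ ?_
  · simp only [Set.forall_mem_image, reachable_map_iff]
  · simp only [Set.forall_mem_image]
    constructor
    · intro h v x hx y hy hxv hyv
      have := h (f v) hx hy (fun e => hxv (f.injective e)) (fun e => hyv (f.injective e))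
      rwa [deleteIncidenceSet_map, reachable_map_iff] at this
    · intro h v x hx y hy hxv hyv
      by_cases hv : ∃ w, f w = v
      · obtain ⟨w, rfl⟩ := hv
        rw [deleteIncidenceSet_map, reachable_map_iff]
        exact h w x hx y hy (fun e => hxv (e ▸ rfl)) (fun e => hyv (e ▸ rfl))
      · have e : (H.map f).deleteIncidenceSet v = H.map f := by
          ext a b
          simp only [deleteIncidenceSet_adj, SimpleGraph.map_adj, and_iff_left_iff_imp]
          rintro ⟨p, q, -, rfl, rfl⟩
          exact ⟨fun e => hv ⟨_, e⟩, fun e => hv ⟨_, e⟩⟩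
        rw [e, reachable_map_iff]
        by_cases hxy : x = y
        · rw [hxy]
        -- a third vertex, if there is one, can be removed without affecting connectedness
        by_cases h3 : ∃ z, z ≠ x ∧ z ≠ y
        · obtain ⟨z, hzx, hzy⟩ := h3
          exact (h z x hx y hy hzx.symm hzy.symm).mono (deleteIncidenceSet_le _ _)
        · obtain ⟨z, hz⟩ := hx
          have : z = y := by
            by_contra hzy
            exact h3 ⟨z, hz.ne', hzy⟩
          exact this ▸ hz.reachable

theorem isPiece_of_connected {V : Type} {H : SimpleGraph V} [Nontrivial V] (hc : H.Connected)
    (hn : NoCutVertex H) : IsPiece H := by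
  refine ⟨?_, fun x _ y _ => hc.preconnected x y,
    fun v x _ y _ hx hy => (noCutVertex_iff H).1 hn v x y hx hy⟩
  rintro rfl
  obtain ⟨x, y, hxy⟩ := exists_pair_ne V
  exact hxy (reachable_bot.1 (hc.preconnected x y))

theorem support_eq_univ_of_connected {V : Type} {H : SimpleGraph V} [Nontrivial V]
    (hc : H.Connected) : H.support = Set.univ := by
  rw [Set.eq_univ_iff_forall]
  intro v
  obtain ⟨w, hw⟩ := exists_ne v
  exact mem_support_of_reachable hw.symm (hc.preconnected v w)

theorem IsPiece.exists_adj {V : Type} {β : SimpleGraph V} (h : IsPiece β) :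
    ∃ x y, β.Adj x y := by
  by_contra! hne
  exact h.1 (by ext a b; simp [hne])

theorem IsPiece.nontrivial_support {V : Type} {β : SimpleGraph V} (h : IsPiece β) :
    β.support.Nontrivial := by
  obtain ⟨x, y, hxy⟩ := h.exists_adj
  exact ⟨x, ⟨y, hxy⟩, y, ⟨x, hxy.symm⟩, hxy.ne⟩

theorem IsPiece.connected_of_support_eq_univ {V : Type} {H : SimpleGraph V} (h : IsPiece H)
    (hs : H.support = Set.univ) : H.Connected ∧ NoCutVertex H := by
  obtain ⟨x, y, hxy⟩ := h.exists_adj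
  have hm : ∀ v, v ∈ H.support := fun v => hs ▸ Set.mem_univ v
  refine ⟨(connected_iff_exists_forall_reachable H).2 ⟨x, fun b => h.2.1 x (hm x) b (hm b)⟩,
    (noCutVertex_iff H).2 ?_⟩
  exact fun v a b ha hb => h.2.2 v a (hm a) b (hm b) ha hb

theorem isBlockGraph_iff {V : Type} [Finite V] (H : SimpleGraph V) :
    IsBlockGraph H ↔ IsPiece H ∧ H.support = Set.univ := by
  constructor
  · rintro (⟨h3, hc, hn⟩ | ⟨h2, rfl⟩)
    · have : Nontrivial V := Finite.one_lt_card_iff_nontrivial.1 (by omega)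
      exact ⟨isPiece_of_connected hc hn, support_eq_univ_of_connected hc⟩
    · have : Nontrivial V := Finite.one_lt_card_iff_nontrivial.1 (by omega)
      have hc : (⊤ : SimpleGraph V).Connected := connected_top
      refine ⟨isPiece_of_connected hc ?_, support_eq_univ_of_connected hc⟩
      intro v x y
      by_cases hxy : x = y
      · rw [hxy]
      · exact Adj.reachable (by simpa [Subtype.ext_iff] using hxy)
  · rintro ⟨hp, hs⟩
    obtain ⟨hc, hn⟩ := hp.connected_of_support_eq_univ hs
    obtain ⟨x, y, hxy⟩ := hp.exists_adj
    have : Nontrivial V := ⟨x, y, hxy.ne⟩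
    have h2 : 1 < Nat.card V := Finite.one_lt_card_iff_nontrivial.2 inferInstance
    by_cases h3 : 3 ≤ Nat.card V
    · exact Or.inl ⟨h3, hc, hn⟩
    · have hcard : Nat.card V = 2 := by omega
      refine Or.inr ⟨hcard, ?_⟩
      have huniv : ∀ z, z = x ∨ z = y := by
        intro z
        by_contra! hz
        have h3' := Set.ncard_le_card ({z, x, y} : Set V)
        rw [Set.ncard_eq_three.2 ⟨z, x, y, hz.1, hz.2, hxy.ne, rfl⟩] at h3'
        omega
      ext a b
      simp only [top_adj]
      refine ⟨fun h => h.ne, fun h => ?_⟩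
      rcases huniv a with rfl | rfl <;> rcases huniv b with rfl | rfl
      · exact (h rfl).elim
      · exact hxy
      · exact hxy.symm
      · exact (h rfl).elim

theorem isPiece_iff_induce {V : Type} (β : SimpleGraph V) :
    IsPiece β ↔ IsPiece (β.induce β.support) := by
  conv_lhs => rw [← spanningCoe_induce_support (G := β)]
  exact isPiece_map_iff _ _

theorem support_induce_support {V : Type} (β : SimpleGraph V) :
    (β.induce β.support).support = Set.univ := by
  rw [Set.eq_univ_iff_forall]
  rintro ⟨v, w, hw⟩
  exact ⟨⟨w, v, hw.symm⟩, hw⟩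

theorem IsPiece.isBlockGraph {V : Type} [Finite V] {β : SimpleGraph V} (h : IsPiece β) :
    IsBlockGraph (β.induce β.support) :=
  (isBlockGraph_iff _).2 ⟨(isPiece_iff_induce β).1 h, support_induce_support β⟩

/-! ### The blocks of a graph as graphs on the same vertex set -/

open scoped Classical

noncomputable instance fintypeSimpleGraph {V : Type} [Finite V] : Fintype (SimpleGraph V) :=
  Fintype.ofFinite _

/-- The blocks of `G` with at least two vertices, as graphs on the vertex set of `G`. -/
noncomputable def blocks {V : Type} [Finite V] (G : SimpleGraph V) : Finset (SimpleGraph V) :=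
  Finset.univ.filter fun B => Maximal (fun β => β ≤ G ∧ IsPiece β) B

/-- The weight of a piece: the `γ`-weight of the graph without its isolated vertices. -/
noncomputable def pieceWeight (γ : BlockWeighting) {V : Type} (β : SimpleGraph V) : ℝ≥0 :=
  γ.weight β.support (β.induce β.support)

/-- The product of the `γ`-weights of the nontrivial blocks of `G`. -/
noncomputable def blockProd (γ : BlockWeighting) {V : Type} [Finite V] (G : SimpleGraph V) : ℝ≥0 :=
  ∏ β ∈ blocks G, pieceWeight γ β

variable {V : Type} [Finite V]

theorem mem_blocks {G B : SimpleGraph V} :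
    B ∈ blocks G ↔ Maximal (fun β => β ≤ G ∧ IsPiece β) B := by
  simp [blocks]

theorem exists_le_block {G β : SimpleGraph V} (h : β ≤ G) (hp : IsPiece β) :
    ∃ B ∈ blocks G, β ≤ B := by
  obtain ⟨B, hB, hm⟩ := (Set.toFinite {β : SimpleGraph V | β ≤ G ∧ IsPiece β}).exists_le_maximal
    (show β ∈ {β : SimpleGraph V | β ≤ G ∧ IsPiece β} from ⟨h, hp⟩)
  exact ⟨B, mem_blocks.2 hm, hB⟩

/-- If every piece of a union of edge-disjoint graphs lies in one of them, the blocks of the union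
are the blocks of these graphs. -/
theorem mem_blocks_iSup {ι : Type} {G : ι → SimpleGraph V}
    (h : ∀ β ≤ ⨆ i, G i, IsPiece β → ∃ i, β ≤ G i)
    (hd : Pairwise fun i j => Disjoint (G i) (G j)) (B : SimpleGraph V) :
    B ∈ blocks (⨆ i, G i) ↔ ∃ i, B ∈ blocks (G i) := by
  simp only [mem_blocks]
  constructor
  · rintro ⟨⟨hB, hp⟩, hm⟩
    obtain ⟨i, hi⟩ := h B hB hp
    exact ⟨i, ⟨hi, hp⟩, fun C hC hBC => hm ⟨hC.1.trans (le_iSup G i), hC.2⟩ hBC⟩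
  · rintro ⟨i, ⟨hB, hp⟩, hm⟩
    refine ⟨⟨hB.trans (le_iSup G i), hp⟩, fun C hC hBC => ?_⟩
    obtain ⟨j, hj⟩ := h C hC.1 hC.2
    by_cases hij : i = j
    · subst hij
      exact hm ⟨hj, hC.2⟩ hBC
    · exact (hp.1 (le_bot_iff.1 (hd hij hB (hBC.trans hj)))).elim

theorem blockProd_iSup (γ : BlockWeighting) {ι : Type} [Fintype ι] {G : ι → SimpleGraph V}
    (h : ∀ β ≤ ⨆ i, G i, IsPiece β → ∃ i, β ≤ G i)
    (hd : Pairwise fun i j => Disjoint (G i) (G j)) :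
    blockProd γ (⨆ i, G i) = ∏ i, blockProd γ (G i) := by
  have e : blocks (⨆ i, G i) = Finset.univ.biUnion fun i => blocks (G i) := by
    ext B
    simp [mem_blocks_iSup h hd]
  rw [blockProd, e, Finset.prod_biUnion]
  · rfl
  · intro i _ j _ hij
    refine Finset.disjoint_left.2 fun B hi hj => ?_
    obtain ⟨⟨hi, hp⟩, -⟩ := mem_blocks.1 hi
    exact hp.1 (le_bot_iff.1 (hd hij hi (mem_blocks.1 hj).1.1))

theorem mem_blocks_sup {G H : SimpleGraph V}
    (h : ∀ β ≤ G ⊔ H, IsPiece β → β ≤ G ∨ β ≤ H) (hd : Disjoint G H) (B : SimpleGraph V) :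
    B ∈ blocks (G ⊔ H) ↔ B ∈ blocks G ∨ B ∈ blocks H := by
  have e : G ⊔ H = ⨆ b : Bool, cond b G H := by rw [iSup_bool_eq]; rfl
  rw [e, mem_blocks_iSup]
  · simp [or_comm]
  · intro β hβ hp
    rcases h β (e ▸ hβ) hp with h | h
    · exact ⟨true, h⟩
    · exact ⟨false, h⟩
  · intro i j hij
    cases i <;> cases j <;> simp_all [hd.symm]

theorem blockProd_sup (γ : BlockWeighting) {G H : SimpleGraph V}
    (h : ∀ β ≤ G ⊔ H, IsPiece β → β ≤ G ∨ β ≤ H) (hd : Disjoint G H) :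
    blockProd γ (G ⊔ H) = blockProd γ G * blockProd γ H := by
  have e : G ⊔ H = ⨆ b : Bool, cond b G H := by rw [iSup_bool_eq]; rfl
  rw [e, blockProd_iSup]
  · simp
  · intro β hβ hp
    rcases h β (e ▸ hβ) hp with h | h
    · exact ⟨true, h⟩
    · exact ⟨false, h⟩
  · intro i j hij
    cases i <;> cases j <;> simp_all [hd.symm]

theorem blocks_bot : blocks (⊥ : SimpleGraph V) = ∅ := by
  ext B
  simp only [mem_blocks, Finset.notMem_empty, iff_false]
  rintro ⟨⟨h, hp⟩, -⟩
  exact hp.1 (le_bot_iff.1 h)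

theorem blocks_eq_empty_iff {G : SimpleGraph V} : blocks G = ∅ ↔ G = ⊥ := by
  refine ⟨fun h => ?_, fun h => h ▸ blocks_bot⟩
  by_contra hG
  obtain ⟨x, y, hxy⟩ : ∃ x y, G.Adj x y := by
    by_contra! hne
    exact hG (by ext a b; simp [hne])
  -- a single edge is a piece
  have hp : IsPiece (edge x y) := by
    have hs : ∀ a ∈ (edge x y).support, a = x ∨ a = y := by
      rintro a ⟨b, hb⟩
      replace hb := (edge_adj ..).1 hb
      tauto
    have hadj : (edge x y).Adj x y := by rw [edge_adj]; exact ⟨Or.inl ⟨rfl, rfl⟩, hxy.ne⟩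
    refine ⟨fun e => ?_, fun a ha b hb => ?_, fun v a ha b hb hav hbv => ?_⟩
    · rw [e] at hadj; exact hadj
    · rcases hs a ha with rfl | rfl <;> rcases hs b hb with rfl | rfl
      exacts [.rfl, hadj.reachable, hadj.symm.reachable, .rfl]
    · have hadj' : v ≠ x → v ≠ y → ((edge x y).deleteIncidenceSet v).Reachable x y :=
        fun h1 h2 => Adj.reachable (deleteIncidenceSet_adj.2 ⟨hadj, h1.symm, h2.symm⟩)
      rcases hs a ha with rfl | rfl <;> rcases hs b hb with rfl | rfl
      exacts [.rfl, hadj' hav.symm hbv.symm, (hadj' hbv.symm hav.symm).symm, .rfl]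
  obtain ⟨B, hB, -⟩ := exists_le_block (G := G) (by
    intro a b hab
    rw [edge_adj] at hab
    rcases hab.1 with ⟨rfl, rfl⟩ | ⟨rfl, rfl⟩
    exacts [hxy, hxy.symm]) hp
  simp [h] at hB

theorem IsPiece.blocks_eq {β : SimpleGraph V} (h : IsPiece β) : blocks β = {β} := by
  ext B
  rw [mem_blocks, Finset.mem_singleton]
  constructor
  · rintro ⟨⟨hB, -⟩, hm⟩
    exact le_antisymm hB (hm ⟨le_rfl, h⟩ hB)
  · rintro rfl
    exact ⟨⟨le_rfl, h⟩, fun C hC _ => hC.1⟩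

theorem blocks_map {W : Type} [Finite W] (f : W ↪ V) (H : SimpleGraph W) :
    blocks (H.map f) = (blocks H).image (SimpleGraph.map f) := by
  have key : ∀ β ≤ H.map f, (β.comap f).map f = β := by
    intro β hβ
    refine le_antisymm (map_comap_le _ _) fun a b hab => ?_
    obtain ⟨x, y, -, rfl, rfl⟩ := (SimpleGraph.map_adj _ _ _ _).1 (hβ hab)
    exact (SimpleGraph.map_adj _ _ _ _).2 ⟨x, y, hab, rfl, rfl⟩
  have hle : ∀ A B : SimpleGraph W, A.map f ≤ B.map f ↔ A ≤ B := fun A B => by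
    rw [map_le_iff_le_comap, comap_map_eq]
  ext B
  simp only [mem_blocks, Finset.mem_image]
  constructor
  · rintro ⟨⟨hB, hp⟩, hm⟩
    refine ⟨B.comap f, ⟨⟨?_, ?_⟩, fun C hC hBC => ?_⟩, key B hB⟩
    · rwa [← hle, key B hB]
    · rwa [← isPiece_map_iff f, key B hB]
    · have := @hm (C.map f) ⟨(hle _ _).2 hC.1, (isPiece_map_iff f C).2 hC.2⟩
        ((key B hB).symm.le.trans ((hle _ _).2 hBC))
      rwa [← key B hB, hle] at this
  · rintro ⟨A, ⟨⟨hA, hp⟩, hm⟩, rfl⟩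
    refine ⟨⟨(hle _ _).2 hA, (isPiece_map_iff f A).2 hp⟩, fun C hC hAC => ?_⟩
    obtain ⟨D, rfl⟩ : ∃ D : SimpleGraph W, D.map f = C := ⟨_, key C hC.1⟩
    rw [hle] at hAC ⊢
    exact hm ⟨(hle _ _).1 hC.1, (isPiece_map_iff f _).1 hC.2⟩ hAC

/-- Isomorphism invariance of the weighting, for a block graph and a piece. -/
theorem weight_eq_pieceWeight_map (γ : BlockWeighting) {W : Type} [Finite W] (f : W ↪ V)
    {H : SimpleGraph W} (hH : IsBlockGraph H) : γ.weight W H = pieceWeight γ (H.map f) := by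
  obtain ⟨-, hs⟩ := (isBlockGraph_iff H).1 hH
  have hs' : ∀ w, f w ∈ (H.map f).support := fun w => by
    rw [support_map, hs]; exact ⟨w, trivial, rfl⟩
  refine γ.weight_iso _ _ _ _ hH ⟨⟨Equiv.ofBijective (fun w => ⟨f w, hs' w⟩) ⟨?_, ?_⟩, ?_⟩⟩
  · intro a b hab
    exact f.injective (congrArg Subtype.val hab)
  · rintro ⟨v, hv⟩
    rw [support_map] at hv
    obtain ⟨w, -, rfl⟩ := hv
    exact ⟨w, rfl⟩
  · intro a b
    simp only [SimpleGraph.map_adj, comap_adj, Function.Embedding.subtype_apply]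
    constructor
    · rintro ⟨u, v, h, hu, hv⟩
      rwa [f.injective hu, f.injective hv] at h
    · exact fun h => ⟨a, b, h, rfl, rfl⟩

theorem pieceWeight_map (γ : BlockWeighting) {W : Type} [Finite W] (f : W ↪ V)
    {H : SimpleGraph W} (hH : IsPiece H) : pieceWeight γ (H.map f) = pieceWeight γ H := by
  conv_lhs => rw [← spanningCoe_induce_support (G := H)]
  rw [SimpleGraph.spanningCoe, SimpleGraph.map_map]
  exact (weight_eq_pieceWeight_map γ ((Function.Embedding.subtype _).trans f)
    hH.isBlockGraph).symm

theorem blockProd_map (γ : BlockWeighting) {W : Type} [Finite W] (f : W ↪ V)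
    (H : SimpleGraph W) : blockProd γ (H.map f) = blockProd γ H := by
  rw [blockProd, blocks_map, Finset.prod_image fun a _ b _ h => SimpleGraph.map_injective f h]
  exact Finset.prod_congr rfl fun B hB => pieceWeight_map γ f (mem_blocks.1 hB).1.2

/-! ### The weight of a graph as the product over its blocks -/

/-- The pieces contained in `G` correspond to the nontrivial connected subgraphs of `G` without
cutvertex. -/
theorem isPiece_spanningCoe_iff {V : Type} {G : SimpleGraph V} (B : G.Subgraph)
    (hB : B.verts.Nontrivial) :
    (B.Connected ∧ NoCutVertex B.coe) ↔
      (IsPiece B.spanningCoe ∧ B.spanningCoe.support = B.verts) := by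
  have := hB.coe_sort
  have hs : B.spanningCoe = B.coe.map (Function.Embedding.subtype _) := by
    rw [← Subgraph.spanningCoe_coe]
  have hs' : B.spanningCoe.support = Subtype.val '' B.coe.support := by
    rw [hs, support_map]; rfl
  rw [Subgraph.connected_iff']
  constructor
  · rintro ⟨hc, hn⟩
    refine ⟨?_, ?_⟩
    · rw [hs, isPiece_map_iff]
      exact isPiece_of_connected hc hn
    · rw [hs', support_eq_univ_of_connected hc]
      simp
  · rintro ⟨hp, hsup⟩
    rw [hs, isPiece_map_iff] at hp
    refine hp.connected_of_support_eq_univ (Set.eq_univ_of_forall fun v => ?_)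
    have hv : (v : V) ∈ B.spanningCoe.support := by rw [hsup]; exact v.2
    rw [hs'] at hv
    obtain ⟨w, hw, hwv⟩ := hv
    rwa [← Subtype.ext hwv]

theorem connWeight_eq_blockProd (γ : BlockWeighting) (G : SimpleGraph V) :
    connWeight γ G = blockProd γ G := by
  rw [connWeight, blockProd, ← finprod_mem_coe_finset]
  -- the subgraph with edges `β` and without isolated vertices
  let sub : ∀ β : SimpleGraph V, β ≤ G → G.Subgraph := fun β h =>
    { verts := β.support, Adj := β.Adj, adj_sub := fun e => h e,
      edge_vert := fun e => ⟨_, e⟩, symm := ⟨fun _ _ e => e.symm⟩ }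
  have hsub : ∀ β (h : β ≤ G), (sub β h).spanningCoe = β := fun β h => rfl
  have hmono : ∀ {B C : G.Subgraph}, B.spanningCoe.support = B.verts →
      C.spanningCoe.support = C.verts → (B ≤ C ↔ B.spanningCoe ≤ C.spanningCoe) := by
    intro B C hB hC
    refine ⟨fun h => Subgraph.spanningCoe_le_of_le h, fun h => ⟨?_, fun _ _ e => h e⟩⟩
    rw [← hB, ← hC]
    exact support_mono h
  refine finprod_mem_eq_of_bijOn (fun B => B.spanningCoe) ⟨?_, ?_, ?_⟩ ?_
  · rintro B ⟨⟨hB, hm⟩, hnt⟩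
    obtain ⟨hp, hs⟩ := (isPiece_spanningCoe_iff B hnt).1 hB
    refine mem_blocks.2 ⟨⟨Subgraph.spanningCoe_le _, hp⟩, fun C hC hBC => ?_⟩
    have := @hm (sub C hC.1) ((isPiece_spanningCoe_iff _ hC.2.nontrivial_support).2 ⟨hC.2, rfl⟩)
      ((hmono hs rfl).2 hBC)
    exact (hmono rfl hs).1 this
  · rintro B ⟨⟨hB, -⟩, hnt⟩ C ⟨⟨hC, -⟩, hnt'⟩ h
    have h1 := ((isPiece_spanningCoe_iff B hnt).1 hB).2
    have h2 := ((isPiece_spanningCoe_iff C hnt').1 hC).2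
    exact le_antisymm ((hmono h1 h2).2 (le_of_eq h)) ((hmono h2 h1).2 (ge_of_eq h))
  · intro β hβ
    obtain ⟨⟨hle, hp⟩, hm⟩ := mem_blocks.1 hβ
    refine ⟨sub β hle, ⟨⟨(isPiece_spanningCoe_iff _ hp.nontrivial_support).2 ⟨hp, rfl⟩, ?_⟩,
      hp.nontrivial_support⟩, rfl⟩
    intro C hC hBC
    have hnt : C.verts.Nontrivial := hp.nontrivial_support.mono hBC.1
    obtain ⟨hpC, hsC⟩ := (isPiece_spanningCoe_iff C hnt).1 hC
    exact (hmono hsC rfl).2 (hm ⟨Subgraph.spanningCoe_le _, hpC⟩ ((hmono rfl hsC).1 hBC))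
  · rintro B ⟨⟨hB, -⟩, hnt⟩
    obtain ⟨hp, hs⟩ := (isPiece_spanningCoe_iff B hnt).1 hB
    have hb : IsBlockGraph B.coe := by
      have := hnt.coe_sort
      rw [Subgraph.connected_iff'] at hB
      rw [isBlockGraph_iff]
      exact ⟨isPiece_of_connected hB.1 hB.2, support_eq_univ_of_connected hB.1⟩
    rw [weight_eq_pieceWeight_map γ (Function.Embedding.subtype _) hb]
    congr 1
    exact Subgraph.spanningCoe_coe B

theorem graphWeight_eq_blockProd (γ : BlockWeighting) (G : SimpleGraph V) :
    graphWeight γ G = blockProd γ G := by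
  have := Fintype.ofFinite G.ConnectedComponent
  rw [graphWeight, finprod_eq_prod_of_fintype]
  have e : ∀ c : G.ConnectedComponent,
      connWeight γ c.toSimpleGraph = blockProd γ c.toSimpleGraph.spanningCoe := fun c => by
    rw [connWeight_eq_blockProd]
    exact (blockProd_map γ _ _).symm
  have hG : G = ⨆ c : G.ConnectedComponent, c.toSimpleGraph.spanningCoe := by
    ext a b
    simp only [iSup_adj, ConnectedComponent.adj_spanningCoe_toSimpleGraph]
    exact ⟨fun h => ⟨G.connectedComponentMk a, rfl, h⟩, fun ⟨_, _, h⟩ => h⟩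
  conv_rhs => rw [hG]
  rw [blockProd_iSup]
  · exact Finset.prod_congr rfl fun c _ => e c
  · rw [← hG]
    intro β hβ hp
    obtain ⟨x, y, hxy⟩ := hp.exists_adj
    refine ⟨G.connectedComponentMk x, fun a b hab => ?_⟩
    rw [ConnectedComponent.adj_spanningCoe_toSimpleGraph]
    refine ⟨?_, hβ hab⟩
    exact ConnectedComponent.sound ((hp.2.1 a ⟨b, hab⟩ x ⟨y, hxy⟩).mono hβ)
  · intro c d hcd
    rw [disjoint_iff]
    ext a b
    simp only [inf_adj, ConnectedComponent.adj_spanningCoe_toSimpleGraph, bot_adj, iff_false]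
    rintro ⟨⟨h1, -⟩, h2, -⟩
    exact hcd (h1.symm.trans h2)

/-! ### Removing the edges of a block -/

/-- No component of `G` contains two elements of `X`. -/
def IsTransversal (G : SimpleGraph V) (X : Set V) : Prop :=
  ∀ x ∈ X, ∀ y ∈ X, G.Reachable x y → x = y

/-- When a vertex `v` of a path is removed, every other vertex of the path is still connected,
along the path, to one of its ends. -/
theorem reachable_or_reachable_of_isPath {V : Type} {H : SimpleGraph V} {x y : V} (p : H.Walk x y)
    (hp : p.IsPath) (v : V) (w : V) (hw : w ∈ p.support) (hwv : w ≠ v) :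
    ((fromEdgeSet {e | e ∈ p.edges}).deleteIncidenceSet v).Reachable w x ∧ x ≠ v ∨
    ((fromEdgeSet {e | e ∈ p.edges}).deleteIncidenceSet v).Reachable w y ∧ y ≠ v := by
  induction p with
  | nil =>
    obtain rfl : w = _ := by simpa using hw
    exact Or.inl ⟨.rfl, hwv⟩
  | @cons a b c hab q ih =>
    have hmono : (fromEdgeSet {e | e ∈ q.edges}).deleteIncidenceSet v ≤
        (fromEdgeSet {e | e ∈ (Walk.cons hab q).edges}).deleteIncidenceSet v := by
      intro s t hst
      simp only [deleteIncidenceSet_adj, fromEdgeSet_adj, Set.mem_ofPred_eq, Walk.edges_cons,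
        List.mem_cons] at hst ⊢
      exact ⟨⟨Or.inr hst.1.1, hst.1.2⟩, hst.2⟩
    rw [Walk.support_cons, List.mem_cons] at hw
    rw [Walk.cons_isPath_iff] at hp
    rcases hw with rfl | hw
    · exact Or.inl ⟨.rfl, hwv⟩
    · rcases ih hp.1 hw with ⟨h1, h2⟩ | ⟨h1, h2⟩
      · by_cases hav : a = v
        · subst hav
          -- the removed vertex is the first one, which the rest of the path avoids
          have hq : ∀ u ∈ q.support, u ≠ a := fun u hu e => hp.2 (e ▸ hu)
          have hb : ((fromEdgeSet {e | e ∈ q.edges}).deleteIncidenceSet a).Reachable b c := by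
            have : (fromEdgeSet {e | e ∈ q.edges}).Reachable b c := by
              refine ⟨q.transfer _ fun e he => ?_⟩
              rw [edgeSet_fromEdgeSet]
              exact ⟨he, fun hd => H.not_isDiag_of_mem_edgeSet (q.edges_subset_edgeSet he) hd⟩
            refine this.mono fun s t hst => ?_
            rw [deleteIncidenceSet_adj]
            have hmem : s(s, t) ∈ q.edges := ((fromEdgeSet_adj _).1 hst).1
            exact ⟨hst, hq _ (q.fst_mem_support_of_mem_edges hmem),
              hq _ (q.snd_mem_support_of_mem_edges hmem)⟩
          exact Or.inr ⟨(h1.trans hb).mono hmono, hq _ q.end_mem_support⟩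
        · refine Or.inl ⟨(h1.mono hmono).trans (Adj.reachable ?_), hav⟩
          simp only [deleteIncidenceSet_adj, fromEdgeSet_adj, Set.mem_ofPred_eq, Walk.edges_cons,
            List.mem_cons]
          exact ⟨⟨Or.inl Sym2.eq_swap, hab.ne'⟩, h2, hav⟩
      · exact Or.inr ⟨h1.mono hmono, h2⟩

/-- Adding a path between two vertices of a piece yields a piece. -/
theorem IsPiece.sup_path {V : Type} {H β : SimpleGraph V} (hβ : IsPiece β) {x y : V}
    (hx : x ∈ β.support) (hy : y ∈ β.support) (p : H.Walk x y) (hp : p.IsPath) :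
    IsPiece (β ⊔ fromEdgeSet {e | e ∈ p.edges}) := by
  set P := fromEdgeSet {e | e ∈ p.edges} with hP
  have hs : ∀ a ∈ (β ⊔ P).support, a ∈ β.support ∨ a ∈ p.support := by
    rintro a ⟨b, hb | hb⟩
    · exact Or.inl ⟨b, hb⟩
    · exact Or.inr (p.fst_mem_support_of_mem_edges ((fromEdgeSet_adj _).1 hb).1)
  have hdel : ∀ v a, a ∈ (β ⊔ P).support → a ≠ v → ∃ z ∈ β.support, z ≠ v ∧
      ((β ⊔ P).deleteIncidenceSet v).Reachable a z := by
    intro v a ha hav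
    have hmono : P.deleteIncidenceSet v ≤ (β ⊔ P).deleteIncidenceSet v := by
      intro s t
      simp only [deleteIncidenceSet_adj]
      exact fun h => ⟨Or.inr h.1, h.2⟩
    rcases hs a ha with ha | ha
    · exact ⟨a, ha, hav, .rfl⟩
    · rcases reachable_or_reachable_of_isPath p hp v a ha hav with h | h
      · exact ⟨x, hx, h.2, h.1.mono hmono⟩
      · exact ⟨y, hy, h.2, h.1.mono hmono⟩
  have hmain : ∀ v, ∀ a ∈ (β ⊔ P).support, ∀ b ∈ (β ⊔ P).support, a ≠ v → b ≠ v →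
      ((β ⊔ P).deleteIncidenceSet v).Reachable a b := by
    intro v a ha b hb hav hbv
    obtain ⟨z, hz, hzv, haz⟩ := hdel v a ha hav
    obtain ⟨w, hw, hwv, hbw⟩ := hdel v b hb hbv
    have hmono : β.deleteIncidenceSet v ≤ (β ⊔ P).deleteIncidenceSet v := by
      intro s t
      simp only [deleteIncidenceSet_adj]
      exact fun h => ⟨Or.inl h.1, h.2⟩
    exact (haz.trans ((hβ.2.2 v z hz w hw hzv hwv).mono hmono)).trans hbw.symm
  have hconn : ∀ a ∈ (β ⊔ P).support, (β ⊔ P).Reachable a x := by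
    intro a ha
    rcases hs a ha with ha | ha
    · exact (hβ.2.1 a ha x hx).mono le_sup_left
    · refine Reachable.mono (le_sup_right : P ≤ _)
        (Reachable.symm ⟨(p.takeUntil a ha).transfer _ ?_⟩)
      intro e he
      rw [hP, edgeSet_fromEdgeSet]
      exact ⟨p.edges_takeUntil_subset_edges ha he, fun hd =>
        H.not_isDiag_of_mem_edgeSet
          (p.edges_subset_edgeSet (p.edges_takeUntil_subset_edges ha he)) hd⟩
  refine ⟨fun e => hβ.1 (le_bot_iff.1 (e ▸ le_sup_left)), ?_, hmain⟩
  exact fun a ha b hb => (hconn a ha).trans (hconn b hb).symm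

/-- After the edges of a block are removed, its vertices lie in distinct components: a path
between two of them would be an ear that extends the block. -/
theorem isTransversal_sdiff_block {G β : SimpleGraph V} (h : β ∈ blocks G) :
    IsTransversal (G \ β) β.support := by
  obtain ⟨⟨hle, hp⟩, hm⟩ := mem_blocks.1 h
  intro x hx y hy hxy
  by_contra hne
  obtain ⟨p, hpath⟩ := hxy.exists_isPath
  have hG : fromEdgeSet {e | e ∈ p.edges} ≤ G \ β := by
    intro s t hst
    exact p.edges_subset_edgeSet ((fromEdgeSet_adj _).1 hst).1
  have hβ := hm ⟨sup_le hle (hG.trans sdiff_le), hp.sup_path hx hy p hpath⟩ le_sup_left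
  cases p with
  | nil => exact hne rfl
  | cons hab q =>
    rename_i b
    have h1 : (fromEdgeSet {e | e ∈ (Walk.cons hab q).edges}).Adj x b := by
      rw [fromEdgeSet_adj]
      exact ⟨by simp, hab.ne⟩
    exact (hG h1).2 (hβ (Or.inr h1))

/-- A piece of the union of `G` and a piece attached at a transversal of `G` cannot have edges
of both kinds: the attaching vertex would be a cutvertex. -/
theorem IsPiece.le_or_le_of_isTransversal {V : Type} {G β H : SimpleGraph V}
    (ht : IsTransversal G β.support) (hH : H ≤ G ⊔ β) (hp : IsPiece H) : H ≤ G ∨ H ≤ β := by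
  by_contra! hcon
  obtain ⟨h1, h2⟩ := hcon
  obtain ⟨x, y, hxy, hxyG⟩ : ∃ x y, H.Adj x y ∧ ¬ G.Adj x y := by
    by_contra! h
    exact h1 fun a b => h a b
  obtain ⟨u, v, huv, huvβ⟩ : ∃ x y, H.Adj x y ∧ ¬ β.Adj x y := by
    by_contra! h
    exact h2 fun a b => h a b
  have hβxy : β.Adj x y := (hH hxy).resolve_left hxyG
  have hGuv : G.Adj u v := (hH huv).resolve_right huvβ
  have hx : x ∈ β.support := ⟨y, hβxy⟩
  have hy : y ∈ β.support := ⟨x, hβxy.symm⟩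
  -- the component `D` of `u` and `v` in `G` meets the support of `β` in at most one vertex
  let D : Set V := {w | G.Reachable u w}
  by_cases hD : ∃ p ∈ β.support, p ∈ D
  · obtain ⟨p, hpβ, hpD⟩ := hD
    have huniq : ∀ q ∈ β.support, q ∈ D → q = p := fun q hq hqD =>
      ht q hq p hpβ ((Reachable.symm hqD).trans hpD)
    have hclosed : ∀ a ∈ D \ {p}, ∀ b, (H.deleteIncidenceSet p).Adj a b → b ∈ D \ {p} := by
      rintro a ⟨haD, hap⟩ b hab
      rw [deleteIncidenceSet_adj] at hab
      refine ⟨?_, hab.2.2⟩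
      rcases hH hab.1 with h | h
      · exact Reachable.trans haD h.reachable
      · exact (hap (huniq a ⟨b, h⟩ haD)).elim
    obtain ⟨u', hu', hu'p, hu's⟩ : ∃ u' ∈ D, u' ≠ p ∧ u' ∈ H.support := by
      by_cases hup : u = p
      · exact ⟨v, hGuv.reachable, fun e => huv.ne (hup.trans e.symm), ⟨u, huv.symm⟩⟩
      · exact ⟨u, Reachable.rfl, hup, ⟨v, huv⟩⟩
    obtain ⟨x', hx'β, hx'p, hx's⟩ : ∃ x' ∈ β.support, x' ≠ p ∧ x' ∈ H.support := by
      by_cases hxp : x = p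
      · exact ⟨y, hy, fun e => hxy.ne (hxp.trans e.symm), ⟨x, hxy.symm⟩⟩
      · exact ⟨x, hx, hxp, ⟨y, hxy⟩⟩
    have := mem_of_reachable hclosed (hp.2.2 p u' hu's x' hx's hu'p hx'p) ⟨hu', hu'p⟩
    exact hx'p (huniq x' hx'β this.1)
  · have hclosed : ∀ a ∈ D, ∀ b, H.Adj a b → b ∈ D := by
      intro a haD b hab
      rcases hH hab with h | h
      · exact Reachable.trans haD h.reachable
      · exact (hD ⟨a, ⟨b, h⟩, haD⟩).elim
    exact hD ⟨x, hx, mem_of_reachable hclosed (hp.2.1 u ⟨v, huv⟩ x ⟨y, hxy⟩) Reachable.rfl⟩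

theorem IsTransversal.disjoint {V : Type} {G β : SimpleGraph V} (ht : IsTransversal G β.support) :
    Disjoint G β := by
  rw [disjoint_iff]
  ext a b
  simp only [inf_adj, bot_adj, iff_false]
  rintro ⟨h1, h2⟩
  exact h1.ne (ht a ⟨b, h2⟩ b ⟨a, h2.symm⟩ h1.reachable)

theorem blocks_sup_piece {G β : SimpleGraph V} (hβ : IsPiece β)
    (ht : IsTransversal G β.support) : blocks (G ⊔ β) = insert β (blocks G) := by
  ext B
  rw [mem_blocks_sup (fun H hH hp => hp.le_or_le_of_isTransversal ht hH) ht.disjoint,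
    hβ.blocks_eq, Finset.mem_insert, Finset.mem_singleton, or_comm]

theorem notMem_blocks_of_isTransversal {G β : SimpleGraph V} (hβ : IsPiece β)
    (ht : IsTransversal G β.support) : β ∉ blocks G := fun h =>
  hβ.1 (le_bot_iff.1 (ht.disjoint (mem_blocks.1 h).1.1 le_rfl))

theorem blockProd_sup_piece (γ : BlockWeighting) {G β : SimpleGraph V} (hβ : IsPiece β)
    (ht : IsTransversal G β.support) :
    blockProd γ (G ⊔ β) = blockProd γ G * pieceWeight γ β := by
  rw [blockProd, blocks_sup_piece hβ ht,
    Finset.prod_insert (notMem_blocks_of_isTransversal hβ ht), mul_comm, blockProd]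

/-- Summing over the graphs with a marked block is the same as summing over the graphs with a
piece attached at a transversal. -/
theorem sum_blocks_eq {M : Type} [AddCommMonoid M]
    (f : SimpleGraph V → SimpleGraph V → M) :
    ∑ G, ∑ β ∈ blocks G, f G β =
      ∑ G, ∑ β with IsPiece β ∧ IsTransversal G β.support, f (G ⊔ β) β := by
  rw [Finset.sum_sigma', Finset.sum_sigma']
  refine Finset.sum_bij' (fun p _ => ⟨p.1 \ p.2, p.2⟩) (fun p _ => ⟨p.1 ⊔ p.2, p.2⟩) ?_ ?_ ?_ ?_ ?_
  · rintro ⟨G, β⟩ h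
    have hb : β ∈ blocks G := by simpa using h
    simpa using ⟨(mem_blocks.1 hb).1.2, isTransversal_sdiff_block hb⟩
  · rintro ⟨G, β⟩ h
    obtain ⟨hp, ht⟩ : IsPiece β ∧ IsTransversal G β.support := by simpa using h
    simp [blocks_sup_piece hp ht]
  · rintro ⟨G, β⟩ h
    have hb : β ∈ blocks G := by simpa using h
    simp [sdiff_sup_cancel (mem_blocks.1 hb).1.1]
  · rintro ⟨G, β⟩ h
    obtain ⟨hp, ht⟩ : IsPiece β ∧ IsTransversal G β.support := by simpa using h
    have : (G ⊔ β) \ β = G := by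
      rw [sup_sdiff_right_self]; exact ht.disjoint.sdiff_eq_left
    simp [this]
  · rintro ⟨G, β⟩ h
    have hb : β ∈ blocks G := by simpa using h
    simp [sdiff_sup_cancel (mem_blocks.1 hb).1.1]

/-! ### Vertex sets of components and transversals -/

noncomputable instance fintypeSet {V : Type} [Finite V] : Fintype (Set V) := Fintype.ofFinite _

/-- The vertex sets of the connected components of `G`. -/
noncomputable def compSets (G : SimpleGraph V) : Finset (Set V) :=
  Finset.univ.filter fun s => ∃ c : G.ConnectedComponent, c.supp = s

/-- The product of the sizes of the connected components of `G`. -/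
noncomputable def compProd (G : SimpleGraph V) : ℕ := ∏ s ∈ compSets G, s.ncard

theorem mem_compSets {G : SimpleGraph V} {s : Set V} :
    s ∈ compSets G ↔ ∃ x ∈ s, ∀ y, y ∈ s ↔ G.Reachable x y := by
  simp only [compSets, Finset.mem_filter, Finset.mem_univ, true_and]
  constructor
  · rintro ⟨c, rfl⟩
    obtain ⟨x, rfl⟩ := c.exists_rep
    exact ⟨x, rfl, fun y => ConnectedComponent.eq.trans reachable_comm⟩
  · rintro ⟨x, -, h⟩
    refine ⟨G.connectedComponentMk x, Set.ext fun y => ?_⟩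
    rw [h, reachable_comm]
    exact ConnectedComponent.eq

theorem mem_iff_of_mem_compSets {G : SimpleGraph V} {s : Set V} (hs : s ∈ compSets G) {x : V}
    (hx : x ∈ s) (y : V) : y ∈ s ↔ G.Reachable x y := by
  obtain ⟨z, -, h⟩ := mem_compSets.1 hs
  rw [h] at hx ⊢
  exact ⟨fun h' => hx.symm.trans h', hx.trans⟩

theorem eq_of_mem_compSets {G : SimpleGraph V} {s t : Set V} (hs : s ∈ compSets G)
    (ht : t ∈ compSets G) {x : V} (hxs : x ∈ s) (hxt : x ∈ t) : s = t :=
  Set.ext fun y => (mem_iff_of_mem_compSets hs hxs y).trans (mem_iff_of_mem_compSets ht hxt y).symm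

theorem nonempty_of_mem_compSets {G : SimpleGraph V} {s : Set V} (hs : s ∈ compSets G) :
    s.Nonempty := (mem_compSets.1 hs).imp fun _ h => h.1

theorem setOf_reachable_mem_compSets (G : SimpleGraph V) (x : V) :
    {y | G.Reachable x y} ∈ compSets G :=
  mem_compSets.2 ⟨x, Reachable.rfl, fun _ => Iff.rfl⟩

theorem compSets_eq_of_cover {G : SimpleGraph V} {P : Finset (Set V)}
    (h : ∀ s ∈ P, ∃ x ∈ s, ∀ y, y ∈ s ↔ G.Reachable x y) (hc : ∀ v, ∃ s ∈ P, v ∈ s) :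
    compSets G = P := by
  have hP : ∀ s ∈ P, s ∈ compSets G := fun s hs => mem_compSets.2 (h s hs)
  refine Finset.ext fun s => ⟨fun hs => ?_, hP s⟩
  obtain ⟨x, hx, -⟩ := mem_compSets.1 hs
  obtain ⟨t, ht, hxt⟩ := hc x
  rwa [eq_of_mem_compSets hs (hP t ht) hx hxt]

theorem ncard_biUnion_eq_sum (P : Finset (Set V))
    (hd : ∀ s ∈ P, ∀ t ∈ P, ∀ x, x ∈ s → x ∈ t → s = t) :
    (⋃ s ∈ P, s).ncard = ∑ s ∈ P, s.ncard := by
  induction P using Finset.induction_on with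
  | empty => simp
  | insert a P ha ih =>
    rw [Finset.set_biUnion_insert, Finset.sum_insert ha, Set.ncard_union_eq, ih]
    · exact fun s hs t ht => hd s (Finset.mem_insert_of_mem hs) t (Finset.mem_insert_of_mem ht)
    · rw [Set.disjoint_left]
      intro x hx hx'
      simp only [Set.mem_iUnion] at hx'
      obtain ⟨s, hs, hxs⟩ := hx'
      have := hd a (Finset.mem_insert_self _ _) s (Finset.mem_insert_of_mem hs) x hx hxs
      exact ha (this ▸ hs)

theorem sum_ncard_compSets (G : SimpleGraph V) : ∑ s ∈ compSets G, s.ncard = Nat.card V := by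
  rw [← ncard_biUnion_eq_sum _ fun s hs t ht x hxs hxt => eq_of_mem_compSets hs ht hxs hxt,
    ← Set.ncard_univ]
  congr 1
  refine Set.eq_univ_of_forall fun x => ?_
  simp only [Set.mem_iUnion]
  exact ⟨_, setOf_reachable_mem_compSets G x, Reachable.rfl⟩

/-- The vertex sets of the components of `G` that meet `X`. -/
noncomputable def compsMeeting (G : SimpleGraph V) (X : Set V) : Finset (Set V) :=
  (compSets G).filter fun s => (s ∩ X).Nonempty

theorem mem_compsMeeting {G : SimpleGraph V} {X s : Set V} :
    s ∈ compsMeeting G X ↔ s ∈ compSets G ∧ (s ∩ X).Nonempty := by simp [compsMeeting]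

theorem compsMeeting_eq_image (G : SimpleGraph V) (X : Set V) :
    (compsMeeting G X : Set (Set V)) = (fun x => {y | G.Reachable x y}) '' X := by
  ext s
  simp only [Finset.mem_coe, mem_compsMeeting, Set.mem_image]
  constructor
  · rintro ⟨hs, x, hxs, hxX⟩
    exact ⟨x, hxX,
      (eq_of_mem_compSets hs (setOf_reachable_mem_compSets G x) hxs Reachable.rfl).symm⟩
  · rintro ⟨x, hx, rfl⟩
    exact ⟨setOf_reachable_mem_compSets G x, x, Reachable.rfl, hx⟩

theorem IsTransversal.card_compsMeeting {G : SimpleGraph V} {X : Set V} (h : IsTransversal G X) :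
    (compsMeeting G X).card = X.ncard := by
  rw [← Set.ncard_coe_finset, compsMeeting_eq_image, Set.InjOn.ncard_image]
  intro x hx y hy hxy
  have : y ∈ {z | G.Reachable x z} := by
    simp only at hxy
    rw [hxy]; exact Reachable.rfl
  exact h x hx y hy this

/-- Attaching a piece at a transversal merges the components that it meets. -/
theorem compSets_sup_piece {G β : SimpleGraph V} (hβ : IsPiece β) :
    compSets (G ⊔ β) = insert (⋃ s ∈ compsMeeting G β.support, s)
      (compSets G \ compsMeeting G β.support) := by
  obtain ⟨x₀, hx₀⟩ := hβ.nontrivial_support.nonempty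
  set A : Set V := ⋃ s ∈ compsMeeting G β.support, s with hA
  have memA : ∀ v, v ∈ A ↔ ∃ x ∈ β.support, G.Reachable x v := by
    intro v
    simp only [hA, Set.mem_iUnion, mem_compsMeeting]
    constructor
    · rintro ⟨s, ⟨hs, x, hxs, hx⟩, hvs⟩
      exact ⟨x, hx, (mem_iff_of_mem_compSets hs hxs v).1 hvs⟩
    · rintro ⟨x, hx, hxv⟩
      exact ⟨_, ⟨setOf_reachable_mem_compSets G x, x, Reachable.rfl, hx⟩, hxv⟩
  refine compSets_eq_of_cover ?_ ?_
  · intro s hs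
    rw [Finset.mem_insert] at hs
    rcases hs with rfl | hs
    · refine ⟨x₀, (memA _).2 ⟨x₀, hx₀, Reachable.rfl⟩, fun y => ⟨fun hy => ?_, fun hy => ?_⟩⟩
      · obtain ⟨x, hx, hxy⟩ := (memA y).1 hy
        exact ((hβ.2.1 x₀ hx₀ x hx).mono le_sup_right).trans (hxy.mono le_sup_left)
      · refine mem_of_reachable ?_ hy ((memA _).2 ⟨x₀, hx₀, Reachable.rfl⟩)
        intro a ha b hab
        rcases hab with h | h
        · obtain ⟨x, hx, hxa⟩ := (memA a).1 ha
          exact (memA b).2 ⟨x, hx, hxa.trans h.reachable⟩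
        · exact (memA b).2 ⟨b, ⟨a, h.symm⟩, Reachable.rfl⟩
    · rw [Finset.mem_sdiff, mem_compsMeeting] at hs
      obtain ⟨hs, hn⟩ := hs
      obtain ⟨x, hx, hxs⟩ := mem_compSets.1 hs
      refine ⟨x, hx, fun y => ⟨fun hy => ((hxs y).1 hy).mono le_sup_left, fun hy => ?_⟩⟩
      refine mem_of_reachable ?_ hy hx
      intro a ha b hab
      rcases hab with h | h
      · exact (hxs b).2 (((hxs a).1 ha).trans h.reachable)
      · exact (hn ⟨hs, a, ha, b, h⟩).elim
  · intro v
    by_cases hv : {y | G.Reachable v y} ∈ compsMeeting G β.support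
    · exact ⟨A, Finset.mem_insert_self _ _, Set.mem_biUnion hv Reachable.rfl⟩
    · exact ⟨_, Finset.mem_insert_of_mem (Finset.mem_sdiff.2
        ⟨setOf_reachable_mem_compSets G v, hv⟩), Reachable.rfl⟩

theorem compsMeeting_subset (G : SimpleGraph V) (X : Set V) : compsMeeting G X ⊆ compSets G :=
  Finset.filter_subset _ _

theorem biUnion_compsMeeting_notMem {G β : SimpleGraph V} (hβ : IsPiece β) :
    (⋃ s ∈ compsMeeting G β.support, s) ∉ compSets G \ compsMeeting G β.support := by
  intro h
  rw [Finset.mem_sdiff] at h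
  obtain ⟨x₀, hx₀⟩ := hβ.nontrivial_support.nonempty
  refine h.2 (mem_compsMeeting.2 ⟨h.1, x₀, ?_, hx₀⟩)
  exact Set.mem_biUnion (mem_compsMeeting.2 ⟨setOf_reachable_mem_compSets G x₀, x₀, Reachable.rfl,
    hx₀⟩) Reachable.rfl

theorem card_compSets_sup_piece {G β : SimpleGraph V} (hβ : IsPiece β)
    (ht : IsTransversal G β.support) :
    (compSets (G ⊔ β)).card + β.support.ncard = (compSets G).card + 1 := by
  rw [compSets_sup_piece hβ, Finset.card_insert_of_notMem (biUnion_compsMeeting_notMem hβ),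
    ← ht.card_compsMeeting]
  have := Finset.card_sdiff_add_card_eq_card (compsMeeting_subset G β.support)
  omega

theorem compProd_sup_piece {G β : SimpleGraph V} (hβ : IsPiece β) :
    compProd (G ⊔ β) = (∑ s ∈ compsMeeting G β.support, s.ncard) *
      ∏ s ∈ compSets G \ compsMeeting G β.support, s.ncard := by
  rw [compProd, compSets_sup_piece hβ, Finset.prod_insert (biUnion_compsMeeting_notMem hβ),
    ncard_biUnion_eq_sum]
  intro s hs t ht x hxs hxt
  exact eq_of_mem_compSets (compsMeeting_subset _ _ hs) (compsMeeting_subset _ _ ht) hxs hxt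

theorem card_transversals (G : SimpleGraph V) {T : Finset (Set V)} (hT : T ⊆ compSets G) :
    (Finset.univ.filter fun X : Set V => IsTransversal G X ∧ compsMeeting G X = T).card =
      ∏ s ∈ T, s.ncard := by
  have e : ∏ s ∈ T, s.ncard = Nat.card ((s : T) → (s : Set V)) := by
    rw [Nat.card_pi, ← Finset.prod_coe_sort]
    rfl
  rw [e, ← Fintype.card_coe, ← Nat.card_eq_fintype_card]
  -- a transversal is the range of a choice of one vertex from every component in `T`
  have huniq : ∀ (f : (s : T) → (s : Set V)) (s t : T), G.Reachable (f s) (f t) → s = t := by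
    intro f s t h
    refine Subtype.ext (eq_of_mem_compSets (hT s.2) (hT t.2) ?_ (f t).2)
    exact (mem_iff_of_mem_compSets (hT s.2) (f s).2 _).2 h
  have hF : ∀ f : (s : T) → (s : Set V), Set.range (fun s => (f s : V)) ∈
      Finset.univ.filter fun X : Set V => IsTransversal G X ∧ compsMeeting G X = T := by
    intro f
    simp only [Finset.mem_filter, Finset.mem_univ, true_and]
    constructor
    · rintro _ ⟨s, rfl⟩ _ ⟨t, rfl⟩ h
      rw [huniq f s t h]
    · ext s
      rw [mem_compsMeeting]
      constructor
      · rintro ⟨hs, _, hxs, t, rfl⟩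
        rw [eq_of_mem_compSets hs (hT t.2) hxs (f t).2]
        exact t.2
      · exact fun hs => ⟨hT hs, f ⟨s, hs⟩, (f ⟨s, hs⟩).2, ⟨s, hs⟩, rfl⟩
  symm
  refine Nat.card_eq_of_bijective (fun f => ⟨Set.range fun s => (f s : V), hF f⟩) ⟨?_, ?_⟩
  · intro f g hfg
    funext s
    have : (f s : V) ∈ Set.range fun s => (g s : V) := by
      rw [← Subtype.mk.inj hfg]; exact ⟨s, rfl⟩
    obtain ⟨t, ht⟩ := this
    have hst : s = t := by
      refine Subtype.ext (eq_of_mem_compSets (hT s.2) (hT t.2) (f s).2 ?_)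
      rw [← ht]; exact (g t).2
    subst hst
    exact Subtype.ext ht.symm
  · rintro ⟨X, hX⟩
    simp only [Finset.mem_filter, Finset.mem_univ, true_and] at hX
    obtain ⟨htr, rfl⟩ := hX
    have hex : ∀ s : (compsMeeting G X : Finset (Set V)), ∃ x : (s : Set V), (x : V) ∈ X :=
      fun s => by
        obtain ⟨-, x, hxs, hx⟩ := mem_compsMeeting.1 s.2
        exact ⟨⟨x, hxs⟩, hx⟩
    choose f hf using hex
    refine ⟨f, Subtype.ext (Set.ext fun x => ⟨?_, fun hx => ?_⟩)⟩
    · rintro ⟨s, rfl⟩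
      exact hf s
    · have hs : {y | G.Reachable x y} ∈ compsMeeting G X :=
        mem_compsMeeting.2 ⟨setOf_reachable_mem_compSets G x, x, Reachable.rfl, hx⟩
      exact ⟨⟨_, hs⟩, (htr x hx _ (hf ⟨_, hs⟩) (f ⟨_, hs⟩).2).symm⟩

/-- The total weight of the graphs in `𝓑` with vertex set `Fin m`. -/
noncomputable def blockW (γ : BlockWeighting) (m : ℕ) : ℝ≥0 :=
  ∑ B : SimpleGraph (Fin m) with IsBlockGraph B, γ.weight (Fin m) B

theorem sum_pieceWeight_of_support (γ : BlockWeighting) (X : Set V) :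
    ∑ β with IsPiece β ∧ β.support = X, pieceWeight γ β = blockW γ X.ncard := by
  let e : Fin X.ncard ≃ X := (Finite.equivFinOfCardEq (Nat.card_coe_set_eq X)).symm
  let f : Fin X.ncard ↪ V := e.toEmbedding.trans (Function.Embedding.subtype _)
  have hr : Set.range f = X := by
    have : ⇑f = Subtype.val ∘ e := rfl
    rw [this, Set.range_comp, e.surjective.range_eq]
    simp
  symm
  refine Finset.sum_bij (fun B _ => B.map f) ?_ ?_ ?_ ?_
  · intro B hB
    obtain ⟨hp, hs⟩ := (isBlockGraph_iff B).1 (by simpa using hB)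
    simp [isPiece_map_iff, hp, support_map, hs, hr]
  · exact fun B _ C _ h => SimpleGraph.map_injective f h
  · intro β hβ
    obtain ⟨hp, hs⟩ : IsPiece β ∧ β.support = X := by simpa using hβ
    have hmap : (β.comap f).map f = β := by
      refine le_antisymm (map_comap_le _ _) fun a b hab => ?_
      obtain ⟨x, rfl⟩ : a ∈ Set.range f := by rw [hr, ← hs]; exact ⟨b, hab⟩
      obtain ⟨y, rfl⟩ : b ∈ Set.range f := by rw [hr, ← hs]; exact ⟨_, hab.symm⟩
      exact (SimpleGraph.map_adj _ _ _ _).2 ⟨x, y, hab, rfl, rfl⟩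
    refine ⟨β.comap f, ?_, hmap⟩
    simp only [Finset.mem_filter, Finset.mem_univ, true_and, isBlockGraph_iff]
    refine ⟨by rwa [← isPiece_map_iff f, hmap], Set.eq_univ_of_forall fun v => ?_⟩
    have hv : f v ∈ ((β.comap f).map f).support := by
      rw [hmap, hs]; exact (e v).2
    rw [support_map] at hv
    obtain ⟨w, hw, hwv⟩ := hv
    rwa [← f.injective hwv]
  · intro B hB
    exact weight_eq_pieceWeight_map γ f (by simpa using hB)

/-- Summing over the pieces attached at transversals of `G`, grouped by the set of components
that get merged. -/
theorem sum_piece_eq_sum_powerset (γ : BlockWeighting) (G : SimpleGraph V)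
    (Φ : Finset (Set V) → ℝ≥0) :
    ∑ β with IsPiece β ∧ IsTransversal G β.support,
        pieceWeight γ β * Φ (compsMeeting G β.support) =
      ∑ T ∈ (compSets G).powerset, blockW γ T.card * (∏ s ∈ T, (s.ncard : ℝ≥0)) * Φ T := by
  have h1 : ∑ β with IsPiece β ∧ IsTransversal G β.support,
        pieceWeight γ β * Φ (compsMeeting G β.support) =
      ∑ X with IsTransversal G X, blockW γ X.ncard * Φ (compsMeeting G X) := by
    rw [← Finset.sum_fiberwise_of_maps_to (g := fun β : SimpleGraph V => β.support)
      (t := Finset.univ.filter fun X : Set V => IsTransversal G X) (by simp)]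
    refine Finset.sum_congr rfl fun X hX => ?_
    have hX' : IsTransversal G X := by simpa using hX
    rw [← sum_pieceWeight_of_support, Finset.sum_mul, Finset.filter_filter]
    refine Finset.sum_congr ?_ fun β hβ => ?_
    · ext β
      simp only [Finset.mem_filter, Finset.mem_univ, true_and]
      constructor
      · exact fun h => ⟨h.1.1, h.2⟩
      · exact fun h => ⟨⟨h.1, h.2 ▸ hX'⟩, h.2⟩
    · have : β.support = X := by
        simp only [Finset.mem_filter] at hβ
        exact hβ.2.2
      rw [this]
  rw [h1, ← Finset.sum_fiberwise_of_maps_to (g := fun X : Set V => compsMeeting G X)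
      (t := (compSets G).powerset) (by simp [compsMeeting_subset])]
  refine Finset.sum_congr rfl fun T hT => ?_
  rw [Finset.filter_filter, Finset.sum_congr rfl (g := fun _ => blockW γ T.card * Φ T)]
  · rw [Finset.sum_const, card_transversals G (Finset.mem_powerset.1 hT), nsmul_eq_mul]
    push_cast
    ring
  · intro X hX
    simp only [Finset.mem_filter, Finset.mem_univ, true_and] at hX
    rw [← hX.1.card_compsMeeting, hX.2]

/-! ### Counting connected graphs by their blocks -/

theorem sum_powersetCard_sum {α : Type} (A : Finset α) (f : α → ℝ≥0) (j : ℕ) :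
    ∑ T ∈ A.powersetCard (j + 1), ∑ s ∈ T, f s = ((A.card - 1).choose j : ℝ≥0) * ∑ s ∈ A, f s := by
  rw [Finset.sum_comm' (t' := A)
    (s' := fun s => (A.powersetCard (j + 1)).filter fun T => s ∈ T)]
  · rw [Finset.mul_sum]
    refine Finset.sum_congr rfl fun s hs => ?_
    rw [Finset.sum_const, nsmul_eq_mul]
    congr 2
    rw [← Finset.card_erase_of_mem hs, ← Finset.card_powersetCard]
    refine Finset.card_bij' (fun T _ => T.erase s) (fun T _ => insert s T) ?_ ?_ ?_ ?_
    · intro T hT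
      simp only [Finset.mem_filter, Finset.mem_powersetCard] at hT ⊢
      refine ⟨Finset.erase_subset_erase _ hT.1.1, ?_⟩
      rw [Finset.card_erase_of_mem hT.2, hT.1.2, Nat.add_sub_cancel]
    · intro T hT
      simp only [Finset.mem_filter, Finset.mem_powersetCard] at hT ⊢
      have hsT : s ∉ T := fun h => Finset.notMem_erase s A (hT.1 h)
      refine ⟨⟨Finset.insert_subset hs (hT.1.trans (Finset.erase_subset _ _)), ?_⟩,
        Finset.mem_insert_self _ _⟩
      rw [Finset.card_insert_of_notMem hsT, hT.2]
    · intro T hT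
      exact Finset.insert_erase (Finset.mem_filter.1 hT).2
    · intro T hT
      exact Finset.erase_insert fun h =>
        Finset.notMem_erase s A ((Finset.mem_powersetCard.1 hT).1 h)
  · intro T s
    simp only [Finset.mem_filter, Finset.mem_powersetCard]
    exact ⟨fun h => ⟨h, h.1.1 h.2⟩, fun h => h.1⟩

/-- The total weight of the graphs on `V` with `k` components and `q` nontrivial blocks, each
counted with the number of ways to choose a root in every component. -/
noncomputable def rootedForestW (γ : BlockWeighting) (V : Type) [Finite V] (k q : ℕ) : ℝ≥0 :=
  ∑ G : SimpleGraph V with (compSets G).card = k ∧ (blocks G).card = q,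
    blockProd γ G * compProd G

theorem card_compSets_le (G : SimpleGraph V) : (compSets G).card ≤ Nat.card V := by
  rw [← sum_ncard_compSets G, Finset.card_eq_sum_ones]
  exact Finset.sum_le_sum fun s hs => (Set.ncard_pos).2 (nonempty_of_mem_compSets hs)

theorem card_compSets_bot_and_compProd_bot : (compSets (⊥ : SimpleGraph V)).card = Nat.card V ∧
    compProd (⊥ : SimpleGraph V) = 1 := by
  have h : ∀ s ∈ compSets (⊥ : SimpleGraph V), s.ncard = 1 := by
    intro s hs
    obtain ⟨x, hx, hxs⟩ := mem_compSets.1 hs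
    rw [Set.ncard_eq_one]
    refine ⟨x, Set.ext fun y => ?_⟩
    rw [hxs, reachable_bot, Set.mem_singleton_iff, eq_comm]
  refine ⟨?_, Finset.prod_eq_one h⟩
  rw [← sum_ncard_compSets ⊥, Finset.card_eq_sum_ones]
  exact Finset.sum_congr rfl fun s hs => (h s hs).symm

theorem rootedForestW_zero (γ : BlockWeighting) (k : ℕ) :
    rootedForestW γ V k 0 = if k = Nat.card V then 1 else 0 := by
  have h : ∀ G : SimpleGraph V, ((compSets G).card = k ∧ (blocks G).card = 0) ↔
      (G = ⊥ ∧ k = Nat.card V) := by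
    intro G
    rw [Finset.card_eq_zero, blocks_eq_empty_iff]
    constructor
    · rintro ⟨h, rfl⟩
      exact ⟨rfl, h.symm.trans card_compSets_bot_and_compProd_bot.1⟩
    · rintro ⟨rfl, h⟩
      exact ⟨card_compSets_bot_and_compProd_bot.1.trans h.symm, rfl⟩
  rw [rootedForestW, Finset.filter_congr fun G _ => h G]
  split_ifs with hk
  · have : (Finset.univ.filter fun G : SimpleGraph V => G = ⊥ ∧ k = Nat.card V) = {⊥} := by
      ext G; simp [hk]
    rw [this, Finset.sum_singleton, card_compSets_bot_and_compProd_bot.2, blockProd, blocks_bot]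
    simp
  · simp [hk]

/-- Double counting of the graphs with a marked block: removing the edges of a block with `j + 1`
vertices turns `k + 1` components into `k + j + 1`. -/
theorem rootedForestW_succ (γ : BlockWeighting) (k q : ℕ) :
    ((q + 1 : ℕ) : ℝ≥0) * rootedForestW γ V (k + 1) (q + 1) =
      ∑ j ∈ Finset.range (Nat.card V + 1), blockW γ (j + 1) * (Nat.card V : ℝ≥0) *
        ((k + j).choose j : ℝ≥0) * rootedForestW γ V (k + j + 1) q := by
  have h1 : ((q + 1 : ℕ) : ℝ≥0) * rootedForestW γ V (k + 1) (q + 1) =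
      ∑ G : SimpleGraph V, ∑ β ∈ blocks G,
        if (compSets G).card = k + 1 ∧ (blocks G).card = q + 1 then
          blockProd γ G * compProd G else 0 := by
    rw [rootedForestW, Finset.mul_sum, Finset.sum_filter]
    refine Finset.sum_congr rfl fun G _ => ?_
    rw [Finset.sum_const, nsmul_eq_mul]
    split_ifs with h
    · rw [h.2]
    · simp
  rw [h1, sum_blocks_eq]
  have h2 : ∀ G : SimpleGraph V,
      (∑ β with IsPiece β ∧ IsTransversal G β.support,
        if (compSets (G ⊔ β)).card = k + 1 ∧ (blocks (G ⊔ β)).card = q + 1 then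
          blockProd γ (G ⊔ β) * (compProd (G ⊔ β) : ℝ≥0) else 0) =
      ∑ j ∈ Finset.range (Nat.card V + 1), blockW γ (j + 1) * (Nat.card V : ℝ≥0) *
        ((k + j).choose j : ℝ≥0) * (if (compSets G).card = k + j + 1 ∧ (blocks G).card = q then
          blockProd γ G * (compProd G : ℝ≥0) else 0) := by
    intro G
    let Φ : Finset (Set V) → ℝ≥0 := fun T =>
      if (compSets G).card = k + T.card ∧ (blocks G).card = q then
        blockProd γ G * ((∑ s ∈ T, (s.ncard : ℝ≥0)) * ∏ s ∈ compSets G \ T, (s.ncard : ℝ≥0)) else 0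
    have h3 : (∑ β with IsPiece β ∧ IsTransversal G β.support,
        if (compSets (G ⊔ β)).card = k + 1 ∧ (blocks (G ⊔ β)).card = q + 1 then
          blockProd γ (G ⊔ β) * (compProd (G ⊔ β) : ℝ≥0) else 0) =
        ∑ β with IsPiece β ∧ IsTransversal G β.support,
          pieceWeight γ β * Φ (compsMeeting G β.support) := by
      refine Finset.sum_congr rfl fun β hβ => ?_
      obtain ⟨hp, ht⟩ : IsPiece β ∧ IsTransversal G β.support := by simpa using hβ
      have hc := card_compSets_sup_piece hp ht
      have hb : (blocks (G ⊔ β)).card = (blocks G).card + 1 := by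
        rw [blocks_sup_piece hp ht,
          Finset.card_insert_of_notMem (notMem_blocks_of_isTransversal hp ht)]
      have hiff : ((compSets (G ⊔ β)).card = k + 1 ∧ (blocks (G ⊔ β)).card = q + 1) ↔
          ((compSets G).card = k + (compsMeeting G β.support).card ∧ (blocks G).card = q) := by
        rw [hb, ht.card_compsMeeting]
        omega
      simp only [Φ, hiff]
      split_ifs
      · rw [blockProd_sup_piece γ hp ht, compProd_sup_piece hp]
        push_cast
        ring
      · simp
    rw [h3, sum_piece_eq_sum_powerset]
    by_cases hq : (blocks G).card = q
    swap
    · simp [Φ, hq]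
    -- only sets of `K - k` components contribute, where `K` is the number of components of `G`
    have h4 : ∀ T ∈ (compSets G).powerset,
        blockW γ T.card * (∏ s ∈ T, (s.ncard : ℝ≥0)) * Φ T =
          if (compSets G).card = k + T.card then
            blockProd γ G * compProd G * (blockW γ T.card * ∑ s ∈ T, (s.ncard : ℝ≥0)) else 0 := by
      intro T hT
      simp only [Φ, hq, and_true]
      split_ifs
      · rw [compProd, ← Finset.prod_sdiff (Finset.mem_powerset.1 hT)]
        push_cast
        ring
      · simp
    rw [Finset.sum_congr rfl h4]
    simp only [hq, and_true]
    rcases Nat.lt_or_ge k (compSets G).card with hk | hk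
    · obtain ⟨j, hj⟩ := Nat.exists_eq_add_of_lt hk
      have hjn : j ∈ Finset.range (Nat.card V + 1) := by
        have := card_compSets_le G
        rw [Finset.mem_range]; omega
      rw [Finset.sum_eq_single_of_mem j hjn]
      · rw [if_pos hj, ← Finset.sum_filter]
        have hset : (compSets G).powerset.filter (fun T => (compSets G).card = k + T.card) =
            (compSets G).powersetCard (j + 1) := by
          ext T
          simp only [Finset.mem_filter, Finset.mem_powerset, Finset.mem_powersetCard]
          exact and_congr_right fun _ => by omega
        rw [hset, ← Finset.mul_sum]
        have : ∑ T ∈ (compSets G).powersetCard (j + 1),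
            blockW γ T.card * ∑ s ∈ T, (s.ncard : ℝ≥0) =
            blockW γ (j + 1) * (((k + j).choose j : ℝ≥0) * (Nat.card V : ℝ≥0)) := by
          have hn : (Nat.card V : ℝ≥0) = ∑ s ∈ compSets G, (s.ncard : ℝ≥0) := by
            rw [← sum_ncard_compSets G]; push_cast; rfl
          have hkj : k + j = (compSets G).card - 1 := by omega
          rw [hn, hkj, ← sum_powersetCard_sum, Finset.mul_sum]
          exact Finset.sum_congr rfl fun T hT => by rw [(Finset.mem_powersetCard.1 hT).2]
        rw [this]
        ring
      · intro i _ hij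
        rw [if_neg (by omega), mul_zero]
    · rw [Finset.sum_eq_zero, Finset.sum_eq_zero]
      · intro j _
        rw [if_neg (by omega), mul_zero]
      · intro T hT
        split_ifs with h
        · have : T = ∅ := Finset.card_eq_zero.1 (by omega)
          simp [this]
        · rfl
  simp only [h2]
  rw [Finset.sum_comm]
  refine Finset.sum_congr rfl fun j _ => ?_
  rw [← Finset.mul_sum, rootedForestW, Finset.sum_filter]

/-- The exponential generating series of the block graphs rooted at a vertex that is not
counted. -/
noncomputable def blockSeries (γ : BlockWeighting) : PowerSeries ℝ≥0 :=
  PowerSeries.mk fun j => blockW γ (j + 1) / (j.factorial : ℝ≥0)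

theorem rootedForestW_eq (γ : BlockWeighting) {N : ℕ} (hV : Nat.card V = N + 1) (q k : ℕ) :
    rootedForestW γ V (k + 1) q * ((k.factorial : ℝ≥0) * (q.factorial : ℝ≥0)) =
      (N.factorial : ℝ≥0) * ((N + 1 : ℕ) : ℝ≥0) ^ q *
        (if k ≤ N then PowerSeries.coeff (N - k) (blockSeries γ ^ q) else 0) := by
  induction q generalizing k with
  | zero =>
    rw [rootedForestW_zero, hV, pow_zero, pow_zero, PowerSeries.coeff_one]
    rcases lt_trichotomy k N with h | rfl | h
    · rw [if_neg (by omega), if_pos h.le, if_neg (by omega)]; simp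
    · simp
    · rw [if_neg (by omega), if_neg (by omega)]; simp
  | succ q ih =>
    have hstep := rootedForestW_succ (V := V) γ k q
    have h1 : rootedForestW γ V (k + 1) (q + 1) *
        ((k.factorial : ℝ≥0) * ((q + 1).factorial : ℝ≥0)) =
        ∑ j ∈ Finset.range (N + 2), PowerSeries.coeff j (blockSeries γ) * ((N + 1 : ℕ) : ℝ≥0) *
          (rootedForestW γ V (k + j + 1) q *
            (((k + j).factorial : ℝ≥0) * (q.factorial : ℝ≥0))) := by
      calc _ = (k.factorial : ℝ≥0) * (q.factorial : ℝ≥0) *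
            (((q + 1 : ℕ) : ℝ≥0) * rootedForestW γ V (k + 1) (q + 1)) := by
            rw [Nat.factorial_succ]; push_cast; ring
        _ = _ := by
            rw [hstep, hV, Finset.mul_sum]
            refine Finset.sum_congr rfl fun j _ => ?_
            have hch : ((k + j).factorial : ℝ≥0) =
                ((k + j).choose j : ℝ≥0) * (j.factorial : ℝ≥0) * (k.factorial : ℝ≥0) := by
              have := Nat.choose_mul_factorial_mul_factorial (Nat.le_add_left j k)
              rw [Nat.add_sub_cancel] at this
              rw [← this]; push_cast; rfl
            have hj : (j.factorial : ℝ≥0) ≠ 0 := by exact_mod_cast j.factorial_ne_zero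
            rw [hch, blockSeries, PowerSeries.coeff_mk]
            field_simp
    rw [h1]
    simp only [ih]
    by_cases hk : k ≤ N
    · rw [if_pos hk, pow_succ' (blockSeries γ), PowerSeries.coeff_mul,
        Finset.Nat.sum_antidiagonal_eq_sum_range_succ_mk, Finset.mul_sum]
      symm
      rw [← Finset.sum_subset (Finset.range_subset_range.2 (show (N - k).succ ≤ N + 2 by omega))]
      · refine Finset.sum_congr rfl fun j hj => ?_
        have : j < N - k + 1 := by simpa using hj
        rw [if_pos (by omega), Nat.sub_add_eq]
        ring
      · intro j _ hj
        have : ¬ j < N - k + 1 := by simpa using hj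
        rw [if_neg (by omega)]
        simp
    · rw [if_neg hk, mul_zero]
      refine Finset.sum_eq_zero fun j _ => ?_
      rw [if_neg (by omega)]
      simp

theorem coeff_blockSeries_pow_of_lt (γ : BlockWeighting) {N q : ℕ} (h : N < q) :
    PowerSeries.coeff N (blockSeries γ ^ q) = 0 := by
  have hX : PowerSeries.X ∣ blockSeries γ := by
    rw [PowerSeries.X_dvd_iff, ← PowerSeries.coeff_zero_eq_constantCoeff_apply, blockSeries,
      PowerSeries.coeff_mk]
    have : blockW γ 1 = 0 := by
      refine Finset.sum_eq_zero fun B hB => ?_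
      exfalso
      rcases (Finset.mem_filter.1 hB).2 with h | h
      · have := h.1; simp at this
      · have := h.1; simp at this
    simp [this]
  exact PowerSeries.X_pow_dvd_iff.1 (pow_dvd_pow_of_dvd hX q) N h

/-- The total weight of the graphs on `V` with the property `P`. -/
noncomputable def propW (γ : BlockWeighting) {V : Type} [Finite V] (P : SimpleGraph V → Prop) :
    ℝ≥0 := ∑ G : SimpleGraph V with P G, blockProd γ G

theorem propW_eq_sum (γ : BlockWeighting) (P : SimpleGraph V → Prop) [DecidablePred P] :
    propW γ P = ∑ G : SimpleGraph V with P G, blockProd γ G := by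
  rw [propW]
  congr!

/-- The total weight of the connected graphs on `V`. -/
noncomputable def connTotal (γ : BlockWeighting) (V : Type) [Finite V] : ℝ≥0 :=
  propW γ fun C : SimpleGraph V => C.Connected

theorem card_compSets_eq_one_iff [Nonempty V] (G : SimpleGraph V) :
    (compSets G).card = 1 ↔ G.Connected := by
  constructor
  · intro h
    obtain ⟨s, hs⟩ := Finset.card_eq_one.1 h
    refine ⟨fun x y => ?_⟩
    have hx := setOf_reachable_mem_compSets G x
    have hy := setOf_reachable_mem_compSets G y
    rw [hs, Finset.mem_singleton] at hx hy
    have : y ∈ {z | G.Reachable x z} := by rw [hx, ← hy]; exact Reachable.rfl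
    exact this
  · intro h
    have : compSets G = {Set.univ} := by
      refine compSets_eq_of_cover ?_ ?_
      · intro s hs
        obtain ⟨x⟩ := h.nonempty
        rw [Finset.mem_singleton.1 hs]
        exact ⟨x, trivial, fun y => ⟨fun _ => h.preconnected x y, fun _ => trivial⟩⟩
      · exact fun v => ⟨_, Finset.mem_singleton_self _, trivial⟩
    rw [this, Finset.card_singleton]

theorem compProd_of_card_compSets_eq_one {G : SimpleGraph V} (h : (compSets G).card = 1) :
    compProd G = Nat.card V := by
  obtain ⟨s, hs⟩ := Finset.card_eq_one.1 h
  have := sum_ncard_compSets G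
  rw [hs, Finset.sum_singleton] at this
  rw [compProd, hs, Finset.prod_singleton, this]

/-- The total weight of the connected graphs in terms of the weights of the block graphs.
In terms of generating series this is the Lagrange inversion formula for the solution
`R` of `R = z exp (B'(R))`. -/
theorem card_mul_connTotal (γ : BlockWeighting) {N : ℕ} (hV : Nat.card V = N + 1) :
    ((N + 1 : ℕ) : ℝ≥0) * connTotal γ V = (N.factorial : ℝ≥0) *
      ∑ q ∈ Finset.range (N + 1), ((N + 1 : ℕ) : ℝ≥0) ^ q / (q.factorial : ℝ≥0) *
        PowerSeries.coeff N (blockSeries γ ^ q) := by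
  have : Nonempty V := (Nat.card_pos_iff.1 (by omega)).1
  have hF : ∀ q, rootedForestW γ V 1 q = (N.factorial : ℝ≥0) *
      (((N + 1 : ℕ) : ℝ≥0) ^ q / (q.factorial : ℝ≥0) *
        PowerSeries.coeff N (blockSeries γ ^ q)) := by
    intro q
    have h := rootedForestW_eq (V := V) γ hV q 0
    have hq : (q.factorial : ℝ≥0) ≠ 0 := by exact_mod_cast q.factorial_ne_zero
    rw [if_pos (Nat.zero_le N), Nat.sub_zero, zero_add, Nat.factorial_zero, Nat.cast_one,
      one_mul] at h
    rw [← mul_right_cancel_iff_of_pos (pos_iff_ne_zero.2 hq), h]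
    field_simp
  have hsum : ((N + 1 : ℕ) : ℝ≥0) * connTotal γ V =
      ∑ q ∈ Finset.range (N + 1 + (Finset.univ : Finset (SimpleGraph V)).card),
        rootedForestW γ V 1 q := by
    rw [connTotal, propW, Finset.mul_sum, ← Finset.sum_fiberwise_of_maps_to
      (g := fun G : SimpleGraph V => (blocks G).card)
      (t := Finset.range (N + 1 + (Finset.univ : Finset (SimpleGraph V)).card))]
    · refine Finset.sum_congr rfl fun q _ => ?_
      rw [rootedForestW, Finset.filter_filter]
      simp only [card_compSets_eq_one_iff]
      refine Finset.sum_congr rfl fun G hG => ?_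
      rw [compProd_of_card_compSets_eq_one
        ((card_compSets_eq_one_iff G).2 (Finset.mem_filter.1 hG).2.1), hV,
        mul_comm]
    · intro G _
      have := Finset.card_le_univ (blocks G)
      rw [Finset.mem_range]
      exact lt_of_le_of_lt this (by rw [← Finset.card_univ]; omega)
  rw [hsum, Finset.mul_sum,
    ← Finset.sum_subset (Finset.range_subset_range.2 (Nat.le_add_right _ _))]
  · exact Finset.sum_congr rfl fun q _ => hF q
  · intro q _ hq
    rw [hF, coeff_blockSeries_pow_of_lt γ (by simpa using hq)]
    simp

/-! ### Splitting off a component -/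

/-- The graph on `V` that consists of `C` on `S` and `D` on the complement of `S`. -/
def glue (S : Set V) (C : SimpleGraph S) (D : SimpleGraph (Sᶜ : Set V)) : SimpleGraph V :=
  C.spanningCoe ⊔ D.spanningCoe

theorem spanningCoe_adj_iff {V : Type} {S : Set V} (C : SimpleGraph S) (a b : V) :
    C.spanningCoe.Adj a b ↔ ∃ (ha : a ∈ S) (hb : b ∈ S), C.Adj ⟨a, ha⟩ ⟨b, hb⟩ := by
  rw [SimpleGraph.spanningCoe, SimpleGraph.map_adj]
  constructor
  · rintro ⟨u, v, h, rfl, rfl⟩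
    exact ⟨u.2, v.2, h⟩
  · rintro ⟨ha, hb, h⟩
    exact ⟨_, _, h, rfl, rfl⟩

theorem glue_adj_iff {V : Type} {S : Set V} (C : SimpleGraph S) (D : SimpleGraph (Sᶜ : Set V))
    (a b : V) : (glue S C D).Adj a b ↔ (∃ (ha : a ∈ S) (hb : b ∈ S), C.Adj ⟨a, ha⟩ ⟨b, hb⟩) ∨
      ∃ (ha : a ∈ Sᶜ) (hb : b ∈ Sᶜ), D.Adj ⟨a, ha⟩ ⟨b, hb⟩ := by
  rw [glue, sup_adj, spanningCoe_adj_iff, spanningCoe_adj_iff]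

theorem induce_glue {V : Type} (S : Set V) (C : SimpleGraph S) (D : SimpleGraph (Sᶜ : Set V)) :
    (glue S C D).induce S = C := by
  ext ⟨a, ha⟩ ⟨b, hb⟩
  simp only [comap_adj, Function.Embedding.subtype_apply, glue_adj_iff]
  constructor
  · rintro (⟨_, _, h⟩ | ⟨h, _⟩)
    · exact h
    · exact (h ha).elim
  · exact fun h => Or.inl ⟨ha, hb, h⟩

theorem induce_compl_glue {V : Type} (S : Set V) (C : SimpleGraph S)
    (D : SimpleGraph (Sᶜ : Set V)) : (glue S C D).induce Sᶜ = D := by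
  ext ⟨a, ha⟩ ⟨b, hb⟩
  simp only [comap_adj, Function.Embedding.subtype_apply, glue_adj_iff]
  constructor
  · rintro (⟨h, _⟩ | ⟨_, _, h⟩)
    · exact (ha h).elim
    · exact h
  · exact fun h => Or.inr ⟨ha, hb, h⟩

theorem glue_induce {G : SimpleGraph V} {S : Set V} (hS : S ∈ compSets G) :
    glue S (G.induce S) (G.induce Sᶜ) = G := by
  have hclosed : ∀ a b, G.Adj a b → a ∈ S → b ∈ S := fun a b h ha =>
    (mem_iff_of_mem_compSets hS ha b).2 h.reachable
  ext a b
  rw [glue_adj_iff]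
  constructor
  · rintro (⟨_, _, h⟩ | ⟨_, _, h⟩) <;> exact h
  · intro h
    by_cases ha : a ∈ S
    · exact Or.inl ⟨ha, hclosed a b h ha, h⟩
    · exact Or.inr ⟨ha, fun hb => ha (hclosed b a h.symm hb), h⟩

theorem connected_induce_of_mem_compSets {G : SimpleGraph V} {S : Set V} (hS : S ∈ compSets G) :
    (G.induce S).Connected := by
  obtain ⟨c, rfl⟩ : ∃ c : G.ConnectedComponent, c.supp = S := by simpa [compSets] using hS
  exact c.connected_toSimpleGraph

theorem blockProd_glue (γ : BlockWeighting) (S : Set V) (C : SimpleGraph S)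
    (D : SimpleGraph (Sᶜ : Set V)) :
    blockProd γ (glue S C D) = blockProd γ C * blockProd γ D := by
  rw [← blockProd_map γ (Function.Embedding.subtype (· ∈ S)) C,
    ← blockProd_map γ (Function.Embedding.subtype (· ∈ Sᶜ)) D]
  refine blockProd_sup γ ?_ ?_
  · intro β hβ hp
    obtain ⟨x, y, hxy⟩ := hp.exists_adj
    have hcl : ∀ A : Set V, (A = S ∨ A = Sᶜ) → ∀ a ∈ A, ∀ b, β.Adj a b → b ∈ A := by
      intro A hA a ha b hab
      have := (glue_adj_iff C D a b).1 (hβ hab)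
      rcases hA with rfl | rfl
      · rcases this with ⟨_, hb, _⟩ | ⟨ha', _⟩
        exacts [hb, (ha' ha).elim]
      · rcases this with ⟨ha', _⟩ | ⟨_, hb, _⟩
        exacts [(ha ha').elim, hb]
    have hall : ∀ A : Set V, (A = S ∨ A = Sᶜ) → x ∈ A → ∀ a b, β.Adj a b → a ∈ A :=
      fun A hA hx a b hab => mem_of_reachable (hcl A hA) (hp.2.1 x ⟨y, hxy⟩ a ⟨b, hab⟩) hx
    by_cases hx : x ∈ S
    · refine Or.inl fun a b hab => ?_
      have ha := hall S (Or.inl rfl) hx a b hab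
      exact (hβ hab).resolve_right fun h =>
        ((spanningCoe_adj_iff (S := Sᶜ) D a b).1 h).1 ha
    · refine Or.inr fun a b hab => ?_
      have ha := hall Sᶜ (Or.inr rfl) hx a b hab
      exact (hβ hab).resolve_left fun h => ha ((spanningCoe_adj_iff (S := S) C a b).1 h).1
  · rw [disjoint_iff]
    ext a b
    simp only [inf_adj, bot_adj, iff_false]
    rintro ⟨h1, h2⟩
    exact ((spanningCoe_adj_iff (S := Sᶜ) D a b).1 h2).1
      ((spanningCoe_adj_iff (S := S) C a b).1 h1).1

theorem reachable_glue_iff {V : Type} {S : Set V} {C : SimpleGraph S} (hC : C.Connected)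
    (D : SimpleGraph (Sᶜ : Set V)) (a b : V) : (glue S C D).Reachable a b ↔
      (a ∈ S ∧ b ∈ S) ∨ ∃ (ha : a ∈ Sᶜ) (hb : b ∈ Sᶜ), D.Reachable ⟨a, ha⟩ ⟨b, hb⟩ := by
  constructor
  · intro h
    by_cases ha : a ∈ S
    · refine Or.inl ⟨ha, mem_of_reachable ?_ h ha⟩
      intro u hu v huv
      rcases (glue_adj_iff C D u v).1 huv with ⟨_, hv, _⟩ | ⟨hu', _⟩
      exacts [hv, (hu' hu).elim]
    · right
      refine mem_of_reachable (A := {b | ∃ (ha : a ∈ Sᶜ) (hb : b ∈ Sᶜ),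
        D.Reachable ⟨a, ha⟩ ⟨b, hb⟩}) ?_ h ⟨ha, ha, Reachable.rfl⟩
      rintro u ⟨ha, hu, hau⟩ v huv
      rcases (glue_adj_iff C D u v).1 huv with ⟨hu', _⟩ | ⟨_, hv, huv⟩
      · exact (hu hu').elim
      · exact ⟨ha, hv, hau.trans huv.reachable⟩
  · rintro (⟨ha, hb⟩ | ⟨ha, hb, h⟩)
    · exact (((reachable_map_iff (Function.Embedding.subtype (· ∈ S)) C ⟨a, ha⟩ ⟨b, hb⟩).2
        (hC.preconnected _ _)).mono le_sup_left)
    · exact (((reachable_map_iff (Function.Embedding.subtype (· ∈ Sᶜ)) D ⟨a, ha⟩ ⟨b, hb⟩).2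
        h).mono le_sup_right)

theorem compSets_glue {S : Set V} {C : SimpleGraph S} (hC : C.Connected)
    (D : SimpleGraph (Sᶜ : Set V)) :
    compSets (glue S C D) = insert S ((compSets D).image fun s => Subtype.val '' s) := by
  refine compSets_eq_of_cover ?_ ?_
  · intro s hs
    rw [Finset.mem_insert, Finset.mem_image] at hs
    rcases hs with rfl | ⟨t, ht, rfl⟩
    · obtain ⟨x⟩ := hC.nonempty
      refine ⟨x, x.2, fun y => ?_⟩
      rw [reachable_glue_iff hC]
      exact ⟨fun h => Or.inl ⟨x.2, h⟩, fun h => h.elim (fun h => h.2) fun h => (h.1 x.2).elim⟩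
    · obtain ⟨x, hx, hxt⟩ := mem_compSets.1 ht
      refine ⟨x, ⟨x, hx, rfl⟩, fun y => ?_⟩
      rw [reachable_glue_iff hC]
      constructor
      · rintro ⟨y, hy, rfl⟩
        exact Or.inr ⟨x.2, y.2, (hxt y).1 hy⟩
      · rintro (⟨h, -⟩ | ⟨_, hy, h⟩)
        · exact (x.2 h).elim
        · exact ⟨⟨y, hy⟩, (hxt _).2 h, rfl⟩
  · intro v
    by_cases hv : v ∈ S
    · exact ⟨S, Finset.mem_insert_self _ _, hv⟩
    · exact ⟨_, Finset.mem_insert_of_mem (Finset.mem_image_of_mem _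
        (setOf_reachable_mem_compSets D ⟨v, hv⟩)), ⟨v, hv⟩, Reachable.rfl, rfl⟩

theorem mem_compSets_glue {S : Set V} {C : SimpleGraph S} (hC : C.Connected)
    (D : SimpleGraph (Sᶜ : Set V)) : S ∈ compSets (glue S C D) := by
  rw [compSets_glue hC]
  exact Finset.mem_insert_self _ _

theorem card_compSets_glue {S : Set V} {C : SimpleGraph S} (hC : C.Connected)
    (D : SimpleGraph (Sᶜ : Set V)) :
    (compSets (glue S C D)).card = (compSets D).card + 1 := by
  rw [compSets_glue hC, Finset.card_insert_of_notMem, Finset.card_image_of_injective]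
  · exact Set.image_injective.2 Subtype.val_injective
  · rw [Finset.mem_image]
    rintro ⟨t, ht, h⟩
    obtain ⟨x, hx⟩ := nonempty_of_mem_compSets ht
    have : (x : V) ∈ S := h.subset ⟨x, hx, rfl⟩
    exact x.2 this

theorem forall_compSets_glue {S : Set V} {C : SimpleGraph S} (hC : C.Connected)
    (D : SimpleGraph (Sᶜ : Set V)) (K : ℕ) :
    (∀ s ∈ compSets (glue S C D), s.ncard ≤ K) ↔ S.ncard ≤ K ∧ ∀ s ∈ compSets D, s.ncard ≤ K := by
  rw [compSets_glue hC]
  simp only [Finset.mem_insert, Finset.mem_image, forall_eq_or_imp, forall_exists_index, and_imp,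
    forall_apply_eq_imp_iff₂, Set.ncard_image_of_injective _ Subtype.val_injective]

/-- Summing over the graphs with a marked component is the same as summing over a connected graph
on a subset and an arbitrary graph on the complement. -/
theorem sum_compSets_eq {M : Type} [AddCommMonoid M] (Φ : SimpleGraph V → Set V → M) :
    ∑ G : SimpleGraph V, ∑ s ∈ compSets G, Φ G s =
      ∑ S : Set V, ∑ C : SimpleGraph S with C.Connected,
        ∑ D : SimpleGraph (Sᶜ : Set V), Φ (glue S C D) S := by
  rw [Finset.sum_comm' (t' := Finset.univ)
    (s' := fun S => Finset.univ.filter fun G => S ∈ compSets G) (by simp)]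
  refine Finset.sum_congr rfl fun S _ => ?_
  rw [← Finset.sum_product']
  refine Finset.sum_bij' (fun G _ => (G.induce S, G.induce Sᶜ)) (fun p _ => glue S p.1 p.2)
    ?_ ?_ ?_ ?_ ?_
  · intro G hG
    have hG : S ∈ compSets G := by simpa using hG
    simpa using connected_induce_of_mem_compSets hG
  · rintro ⟨C, D⟩ h
    have hC : C.Connected := by simpa using h
    simpa using mem_compSets_glue hC D
  · intro G hG
    exact glue_induce (by simpa using hG)
  · rintro ⟨C, D⟩ _
    simp only [induce_glue, induce_compl_glue]
  · intro G hG
    simp only [glue_induce (show S ∈ compSets G by simpa using hG)]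

theorem sum_set_ncard (f : ℕ → ℝ≥0) :
    ∑ S : Set V, f S.ncard =
      ∑ b ∈ Finset.range (Nat.card V + 1), ((Nat.card V).choose b : ℝ≥0) * f b := by
  have := Fintype.ofFinite V
  have h := Finset.sum_powerset_apply_card f (x := (Finset.univ : Finset V))
  rw [Finset.card_univ, ← Nat.card_eq_fintype_card] at h
  simp only [nsmul_eq_mul] at h
  rw [← h]
  refine Finset.sum_bij (fun S _ => S.toFinset) (by simp) (by simp) ?_ ?_
  · exact fun T _ => ⟨(T : Set V), by simp, by simp⟩
  · intro S _
    rw [Set.ncard_eq_toFinset_card']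

/-! ### Counting graphs by their number of components -/

/-- The coefficients of the exponential generating series of connected graphs. -/
noncomputable def connCoeff (γ : BlockWeighting) (n : ℕ) : ℝ≥0 :=
  connTotal γ (Fin n) / (n.factorial : ℝ≥0)

theorem connTotal_of_isEmpty (γ : BlockWeighting) [IsEmpty V] : connTotal γ V = 0 := by
  refine Finset.sum_eq_zero fun C hC => ?_
  exact (not_isEmpty_of_nonempty V (h := (Finset.mem_filter.1 hC).2.nonempty) ‹_›).elim

theorem connTotal_eq (γ : BlockWeighting) :
    connTotal γ V = ((Nat.card V).factorial : ℝ≥0) * connCoeff γ (Nat.card V) := by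
  have hf : ((Nat.card V).factorial : ℝ≥0) ≠ 0 := by exact_mod_cast Nat.factorial_ne_zero _
  rw [connCoeff, mul_div_cancel₀ _ hf]
  rcases hV : Nat.card V with _ | N
  · have h1 : IsEmpty V := (Finite.card_eq_zero_iff).1 hV
    rw [connTotal_of_isEmpty, connTotal_of_isEmpty]
  · have h1 := card_mul_connTotal (V := V) γ hV
    have h2 := card_mul_connTotal (V := Fin (N + 1)) γ (N := N) (by simp)
    rw [← h2] at h1
    exact mul_left_cancel₀ (by exact_mod_cast N.succ_ne_zero) h1

theorem connCoeff_zero (γ : BlockWeighting) : connCoeff γ 0 = 0 := by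
  rw [connCoeff, connTotal_of_isEmpty, zero_div]

/-- The total weight of the graphs on `V` with `j` components, all of size at most `K`. -/
noncomputable def boundedForestW (γ : BlockWeighting) (K j : ℕ) (V : Type) [Finite V] : ℝ≥0 :=
  ∑ G : SimpleGraph V with (compSets G).card = j ∧ ∀ s ∈ compSets G, s.ncard ≤ K, blockProd γ G

/-- The coefficients of `C ^ j / j!` for the polynomial `C` that consists of the terms of the
generating series of connected graphs up to the degree `K`. -/
noncomputable def boundedForestCoeff (γ : BlockWeighting) (K : ℕ) : ℕ → ℕ → ℝ≥0
  | 0, n => if n = 0 then 1 else 0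
  | j + 1, n => (∑ b ∈ Finset.range (n + 1),
      if b ≤ K then connCoeff γ b * boundedForestCoeff γ K j (n - b) else 0) / ((j + 1 : ℕ) : ℝ≥0)

theorem card_compl_set (S : Set V) : Nat.card (Sᶜ : Set V) = Nat.card V - S.ncard := by
  rw [Nat.card_coe_set_eq, Set.ncard_compl]

theorem boundedForestW_eq (γ : BlockWeighting) (K j : ℕ) (V : Type) [Finite V] :
    boundedForestW γ K j V =
      ((Nat.card V).factorial : ℝ≥0) * boundedForestCoeff γ K j (Nat.card V) := by
  induction j generalizing V with
  | zero =>
    rw [boundedForestCoeff]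
    split_ifs with hV
    · have : IsEmpty V := (Finite.card_eq_zero_iff).1 hV
      have he : ∀ G : SimpleGraph V, G = ⊥ := fun G => by ext x; exact isEmptyElim x
      have hu : (Finset.univ.filter fun G : SimpleGraph V =>
          (compSets G).card = 0 ∧ ∀ s ∈ compSets G, s.ncard ≤ K) = {⊥} := by
        ext G
        have h0 : (compSets G).card = 0 := by have := card_compSets_le G; omega
        simp [he G, Finset.card_eq_zero.1 (he G ▸ h0)]
      rw [boundedForestW, hu, Finset.sum_singleton, blockProd, blocks_bot, hV]
      simp
    · rw [mul_zero]
      refine Finset.sum_eq_zero fun G hG => ?_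
      exfalso
      have h0 := (Finset.mem_filter.1 hG).2.1
      have := sum_ncard_compSets G
      rw [Finset.card_eq_zero.1 h0, Finset.sum_empty] at this
      exact hV this.symm
  | succ j ih =>
    have hj : ((j + 1 : ℕ) : ℝ≥0) ≠ 0 := by exact_mod_cast j.succ_ne_zero
    have h1 : ((j + 1 : ℕ) : ℝ≥0) * boundedForestW γ K (j + 1) V =
        ∑ S : Set V, if S.ncard ≤ K then connTotal γ S * boundedForestW γ K j (Sᶜ : Set V)
          else 0 := by
      calc _ = ∑ G : SimpleGraph V, ∑ s ∈ compSets G,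
            if (compSets G).card = j + 1 ∧ ∀ s ∈ compSets G, s.ncard ≤ K then blockProd γ G
              else 0 := by
            rw [boundedForestW, Finset.mul_sum, Finset.sum_filter]
            refine Finset.sum_congr rfl fun G _ => ?_
            rw [Finset.sum_const, nsmul_eq_mul]
            split_ifs with h
            · rw [h.1]
            · simp
        _ = _ := by
            rw [sum_compSets_eq]
            refine Finset.sum_congr rfl fun S _ => ?_
            rw [connTotal, propW_eq_sum, boundedForestW, Finset.sum_mul_sum]
            split_ifs with hS
            · refine Finset.sum_congr rfl fun C hC => ?_
              have hC : C.Connected := by simpa using hC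
              rw [Finset.sum_filter]
              refine Finset.sum_congr rfl fun D _ => ?_
              simp only [card_compSets_glue hC, forall_compSets_glue hC, blockProd_glue]
              simp [hS]
            · refine Finset.sum_eq_zero fun C hC => Finset.sum_eq_zero fun D _ => ?_
              have hC : C.Connected := by simpa using hC
              simp only [forall_compSets_glue hC, hS, false_and, and_false, if_false]
    let f : ℕ → ℝ≥0 := fun b => if b ≤ K then ((b.factorial : ℝ≥0) * connCoeff γ b) *
      (((Nat.card V - b).factorial : ℝ≥0) * boundedForestCoeff γ K j (Nat.card V - b)) else 0
    have h2 : ∀ S : Set V,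
        (if S.ncard ≤ K then connTotal γ S * boundedForestW γ K j (Sᶜ : Set V) else 0) =
        f S.ncard := by
      intro S
      simp only [f, connTotal_eq, ih, card_compl_set, Nat.card_coe_set_eq S]
    rw [← mul_right_inj' hj, h1, Finset.sum_congr rfl fun S _ => h2 S, sum_set_ncard f,
      boundedForestCoeff, mul_left_comm, mul_div_cancel₀ _ hj, Finset.mul_sum]
    refine Finset.sum_congr rfl fun b hb => ?_
    simp only [f]
    split_ifs
    · have hb : b ≤ Nat.card V := by simpa [Nat.lt_succ_iff] using hb
      rw [← Nat.choose_mul_factorial_mul_factorial hb]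
      push_cast
      ring
    · simp

/-- The weight of the graphs whose largest component has a given size `k` is bounded by the
weight of the graphs with a marked component of size `k` and no larger component. -/
theorem sum_largest_le (γ : BlockWeighting) (k : ℕ) (hk : k ≤ Nat.card V) :
    propW γ (fun G : SimpleGraph V => (∀ s ∈ compSets G, s.ncard ≤ k) ∧
        ∃ s ∈ compSets G, s.ncard = k) ≤
      ((Nat.card V).factorial : ℝ≥0) * (connCoeff γ k *
        ∑ j ∈ Finset.range (Nat.card V - k + 1), boundedForestCoeff γ k j (Nat.card V - k)) := by
  let f : ℕ → ℝ≥0 := fun b => if b = k then ((b.factorial : ℝ≥0) * connCoeff γ b) *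
    (((Nat.card V - b).factorial : ℝ≥0) * ∑ j ∈ Finset.range (Nat.card V - k + 1),
      boundedForestCoeff γ k j (Nat.card V - b)) else 0
  calc _ ≤ ∑ G : SimpleGraph V, ∑ s ∈ compSets G,
        if (∀ s ∈ compSets G, s.ncard ≤ k) ∧ s.ncard = k then blockProd γ G else 0 := by
        rw [propW, Finset.sum_filter]
        refine Finset.sum_le_sum fun G _ => ?_
        split_ifs with h
        · obtain ⟨h1, s, hs, hsk⟩ := h
          refine le_trans ?_ (Finset.single_le_sum (fun _ _ => zero_le) hs)
          rw [if_pos ⟨h1, hsk⟩]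
        · exact zero_le
    _ = ∑ S : Set V, f S.ncard := by
        rw [sum_compSets_eq]
        refine Finset.sum_congr rfl fun S _ => ?_
        simp only [f]
        split_ifs with hS
        · have hD : ((Nat.card V - S.ncard).factorial : ℝ≥0) *
              ∑ j ∈ Finset.range (Nat.card V - k + 1),
                boundedForestCoeff γ k j (Nat.card V - S.ncard) =
              ∑ D : SimpleGraph (Sᶜ : Set V) with ∀ s ∈ compSets D, s.ncard ≤ k,
                blockProd γ D := by
            rw [← card_compl_set, Finset.mul_sum]
            simp only [← boundedForestW_eq]
            rw [← Finset.sum_fiberwise_of_maps_to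
              (g := fun D : SimpleGraph (Sᶜ : Set V) => (compSets D).card)
              (t := Finset.range (Nat.card V - k + 1))]
            · refine Finset.sum_congr rfl fun j _ => ?_
              rw [boundedForestW, Finset.filter_filter]
              simp only [and_comm]
            · intro D _
              have := card_compSets_le D
              rw [card_compl_set, hS] at this
              exact Finset.mem_range.2 (Nat.lt_succ_of_le this)
          rw [hD, ← Nat.card_coe_set_eq, ← connTotal_eq, connTotal, propW_eq_sum,
            Finset.sum_mul_sum]
          refine Finset.sum_congr rfl fun C hC => ?_
          have hC : C.Connected := by simpa using hC
          rw [Finset.sum_filter]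
          refine Finset.sum_congr rfl fun D _ => ?_
          simp only [forall_compSets_glue hC, blockProd_glue, Nat.card_coe_set_eq]
          simp [hS]
        · refine Finset.sum_eq_zero fun C _ => Finset.sum_eq_zero fun D _ => ?_
          rw [if_neg fun h => hS h.2]
    _ = _ := by
        rw [sum_set_ncard f, Finset.sum_eq_single_of_mem k (Finset.mem_range.2 (by omega))]
        · simp only [f]
          rw [if_true, ← Nat.choose_mul_factorial_mul_factorial hk]
          push_cast
          ring
        · intro b _ hb
          simp only [f]
          rw [if_neg hb, mul_zero]

theorem factorial_mul_boundedForestCoeff_le (γ : BlockWeighting) (j : ℕ) :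
    ((Nat.card V).factorial : ℝ≥0) * boundedForestCoeff γ (Nat.card V) j (Nat.card V) ≤
      ∑ G : SimpleGraph V, blockProd γ G := by
  rw [← boundedForestW_eq]
  exact Finset.sum_le_sum_of_subset (Finset.filter_subset _ _)

/-! ### Inequalities between the coefficients of the series of connected graphs -/

/-- The coefficient of `u ^ N` in `exp (x B'(u))`. -/
noncomputable def expCoeff (γ : BlockWeighting) (N : ℕ) (x : ℝ≥0) : ℝ≥0 :=
  ∑ q ∈ Finset.range (N + 1), x ^ q / (q.factorial : ℝ≥0) *
    PowerSeries.coeff N (blockSeries γ ^ q)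

theorem sq_mul_connCoeff (γ : BlockWeighting) (N : ℕ) :
    ((N + 1 : ℕ) : ℝ≥0) ^ 2 * connCoeff γ (N + 1) = expCoeff γ N ((N + 1 : ℕ) : ℝ≥0) := by
  have h := card_mul_connTotal (V := Fin (N + 1)) γ (N := N) (by simp)
  have h1 : (N.factorial : ℝ≥0) ≠ 0 := by exact_mod_cast N.factorial_ne_zero
  have h2 : ((N + 1 : ℕ) : ℝ≥0) ≠ 0 := by exact_mod_cast N.succ_ne_zero
  rw [connCoeff, Nat.factorial_succ, Nat.cast_mul, ← mul_right_inj' h1, expCoeff, ← h]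
  field_simp

theorem connCoeff_one (γ : BlockWeighting) : connCoeff γ 1 = 1 := by
  have h := sq_mul_connCoeff γ 0
  simpa [expCoeff] using h

theorem coeff_mul_coeff_le (A B : PowerSeries ℝ≥0) (i j : ℕ) :
    PowerSeries.coeff i A * PowerSeries.coeff j B ≤ PowerSeries.coeff (i + j) (A * B) := by
  rw [PowerSeries.coeff_mul]
  exact Finset.single_le_sum (f := fun p : ℕ × ℕ => PowerSeries.coeff p.1 A *
    PowerSeries.coeff p.2 B) (fun _ _ => zero_le) (a := (i, j)) (by simp)

theorem add_pow_div_factorial (x y : ℝ≥0) (s : ℕ) : (x + y) ^ s / (s.factorial : ℝ≥0) =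
    ∑ p ∈ Finset.HasAntidiagonal.antidiagonal s,
      x ^ p.1 / (p.1.factorial : ℝ≥0) * (y ^ p.2 / (p.2.factorial : ℝ≥0)) := by
  have hs : ∀ s : ℕ, (s.factorial : ℝ≥0) ≠ 0 := fun s => by exact_mod_cast s.factorial_ne_zero
  rw [(Commute.all x y).add_pow', Finset.sum_div]
  refine Finset.sum_congr rfl fun p hp => ?_
  rw [Finset.HasAntidiagonal.mem_antidiagonal] at hp
  rw [← hp, nsmul_eq_mul, div_eq_iff (hs _), ← Nat.add_choose_mul_factorial_mul_factorial]
  have h1 := hs p.1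
  have h2 := hs p.2
  rw [Nat.choose_symm_add]
  push_cast
  field_simp

theorem expCoeff_mul_le (γ : BlockWeighting) (i j : ℕ) (x y : ℝ≥0) :
    expCoeff γ i x * expCoeff γ j y ≤ expCoeff γ (i + j) (x + y) := by
  rw [expCoeff, expCoeff, Finset.sum_mul_sum, ← Finset.sum_product',
    ← Finset.sum_fiberwise_of_maps_to (g := fun p : ℕ × ℕ => p.1 + p.2)
      (t := Finset.range (i + j + 1)) (by
        intro p hp
        simp only [Finset.mem_product, Finset.mem_range] at hp ⊢
        omega), expCoeff]
  refine Finset.sum_le_sum fun s _ => ?_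
  rw [add_pow_div_factorial, Finset.sum_mul]
  refine (Finset.sum_le_sum_of_subset (t := Finset.HasAntidiagonal.antidiagonal s) ?_).trans
    (Finset.sum_le_sum fun p hp => ?_)
  · intro p hp
    simpa using (Finset.mem_filter.1 hp).2
  · rw [Finset.HasAntidiagonal.mem_antidiagonal] at hp
    calc _ = x ^ p.1 / (p.1.factorial : ℝ≥0) * (y ^ p.2 / (p.2.factorial : ℝ≥0)) *
          (PowerSeries.coeff i (blockSeries γ ^ p.1) *
            PowerSeries.coeff j (blockSeries γ ^ p.2)) := by ring
      _ ≤ _ := by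
          rw [← hp, pow_add]
          gcongr
          exact coeff_mul_coeff_le _ _ _ _

theorem expCoeff_succ_le (γ : BlockWeighting) (m : ℕ) :
    expCoeff γ m ((m + 2 : ℕ) : ℝ≥0) ≤ 3 * expCoeff γ m ((m + 1 : ℕ) : ℝ≥0) := by
  rw [expCoeff, expCoeff, Finset.mul_sum]
  refine Finset.sum_le_sum fun q hq => ?_
  have hq : q ≤ m + 1 := by have := Finset.mem_range.1 hq; omega
  have key : ((m + 2 : ℕ) : ℝ≥0) ^ q ≤ 3 * ((m + 1 : ℕ) : ℝ≥0) ^ q := by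
    rw [← NNReal.coe_le_coe]
    push_cast
    have hm : (0 : ℝ) < m + 1 := by positivity
    have h1 : ((m : ℝ) + 2) = (1 + 1 / (m + 1)) * (m + 1) := by field_simp; ring
    rw [h1, mul_pow]
    gcongr
    calc (1 + 1 / ((m : ℝ) + 1)) ^ q ≤ (1 + 1 / ((m : ℝ) + 1)) ^ (m + 1) := by
          gcongr
          simp [hm.le]
      _ ≤ Real.exp (1 / ((m : ℝ) + 1)) ^ (m + 1) := by
          gcongr
          rw [add_comm]
          exact Real.add_one_le_exp _
      _ = Real.exp 1 := by
          rw [← Real.exp_nat_mul]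
          congr 1
          push_cast
          field_simp
      _ ≤ 3 := Real.exp_one_lt_three.le
  calc _ ≤ (3 * ((m + 1 : ℕ) : ℝ≥0) ^ q) / (q.factorial : ℝ≥0) *
        PowerSeries.coeff m (blockSeries γ ^ q) := by gcongr
    _ = _ := by ring

/-- Two components cost a summable factor more than a single component and an isolated vertex. -/
theorem connCoeff_mul_le (γ : BlockWeighting) {a b : ℕ} (hb : 1 ≤ b) (hab : b ≤ a) :
    connCoeff γ a * connCoeff γ b ≤ 12 / (b : ℝ≥0) ^ 2 * connCoeff γ (a + b - 1) := by
  obtain ⟨j, rfl⟩ := Nat.exists_eq_add_of_le' hb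
  obtain ⟨i, rfl⟩ := Nat.exists_eq_add_of_le' (hb.trans hab)
  have hij : i + 1 + (j + 1) - 1 = i + j + 1 := by omega
  have ha0 : ((i + 1 : ℕ) : ℝ≥0) ^ 2 ≠ 0 := pow_ne_zero _ (by exact_mod_cast i.succ_ne_zero)
  have hb0 : ((j + 1 : ℕ) : ℝ≥0) ^ 2 ≠ 0 := pow_ne_zero _ (by exact_mod_cast j.succ_ne_zero)
  have h1 := expCoeff_mul_le γ i j ((i + 1 : ℕ) : ℝ≥0) ((j + 1 : ℕ) : ℝ≥0)
  have hcast : ((i + 1 : ℕ) : ℝ≥0) + ((j + 1 : ℕ) : ℝ≥0) = ((i + j + 2 : ℕ) : ℝ≥0) := by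
    push_cast; ring
  rw [hcast, ← sq_mul_connCoeff, ← sq_mul_connCoeff] at h1
  have h2 := h1.trans (expCoeff_succ_le γ (i + j))
  rw [← sq_mul_connCoeff] at h2
  have h3 : ((i + j + 1 : ℕ) : ℝ≥0) ^ 2 ≤ 4 * ((i + 1 : ℕ) : ℝ≥0) ^ 2 := by
    have h4 : ((i + j + 1 : ℕ) : ℝ≥0) ≤ 2 * ((i + 1 : ℕ) : ℝ≥0) := by
      have : i + j + 1 ≤ 2 * (i + 1) := by omega
      exact_mod_cast this
    calc _ ≤ (2 * ((i + 1 : ℕ) : ℝ≥0)) ^ 2 := by gcongr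
      _ = _ := by ring
  have h5 : ((i + 1 : ℕ) : ℝ≥0) ^ 2 * (connCoeff γ (i + 1) * connCoeff γ (j + 1) *
      ((j + 1 : ℕ) : ℝ≥0) ^ 2) ≤ ((i + 1 : ℕ) : ℝ≥0) ^ 2 * (12 * connCoeff γ (i + j + 1)) := by
    calc _ = ((i + 1 : ℕ) : ℝ≥0) ^ 2 * connCoeff γ (i + 1) *
          (((j + 1 : ℕ) : ℝ≥0) ^ 2 * connCoeff γ (j + 1)) := by ring
      _ ≤ _ := h2
      _ ≤ 3 * ((4 * ((i + 1 : ℕ) : ℝ≥0) ^ 2) * connCoeff γ (i + j + 1)) := by gcongr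
      _ = _ := by ring
  have h6 := le_of_mul_le_mul_left h5 (pos_iff_ne_zero.2 ha0)
  rw [hij, div_mul_eq_mul_div]
  exact (le_div_iff₀ (pos_iff_ne_zero.2 hb0)).2 h6

/-- Attaching a block of a size that occurs changes the coefficient by a bounded factor. -/
theorem exists_connCoeff_le (γ : BlockWeighting) {l : ℕ} (h : blockW γ (l + 2) ≠ 0) :
    ∃ C : ℝ≥0, 1 ≤ C ∧ ∀ i, connCoeff γ (i + 1) ≤ C * connCoeff γ (i + 1 + (l + 1)) := by
  set δ := expCoeff γ (l + 1) ((l + 1 : ℕ) : ℝ≥0) with hδ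
  have hδ0 : δ ≠ 0 := by
    have hle : ((l + 1 : ℕ) : ℝ≥0) ^ 1 / ((1 : ℕ).factorial : ℝ≥0) *
        PowerSeries.coeff (l + 1) (blockSeries γ ^ 1) ≤ δ := by
      rw [hδ, expCoeff]
      exact Finset.single_le_sum (f := fun q => ((l + 1 : ℕ) : ℝ≥0) ^ q / (q.factorial : ℝ≥0) *
        PowerSeries.coeff (l + 1) (blockSeries γ ^ q)) (fun _ _ => zero_le)
        (Finset.mem_range.2 (show 1 < l + 1 + 1 by omega))
    refine ne_of_gt (lt_of_lt_of_le ?_ hle)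
    rw [pow_one, pow_one, blockSeries, PowerSeries.coeff_mk]
    have h1 : (0 : ℝ≥0) < blockW γ (l + 1 + 1) := pos_iff_ne_zero.2 h
    have h2 : (0 : ℝ≥0) < ((l + 1).factorial : ℝ≥0) := by exact_mod_cast (l + 1).factorial_pos
    positivity
  refine ⟨max 1 (((l + 2 : ℕ) : ℝ≥0) ^ 2 / δ), le_max_left _ _, fun i => ?_⟩
  have ha0 : ((i + 1 : ℕ) : ℝ≥0) ^ 2 ≠ 0 := pow_ne_zero _ (by exact_mod_cast i.succ_ne_zero)
  have h1 := expCoeff_mul_le γ i (l + 1) ((i + 1 : ℕ) : ℝ≥0) ((l + 1 : ℕ) : ℝ≥0)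
  have hcast : ((i + 1 : ℕ) : ℝ≥0) + ((l + 1 : ℕ) : ℝ≥0) = ((i + (l + 1) + 1 : ℕ) : ℝ≥0) := by
    push_cast; ring
  rw [hcast, ← sq_mul_connCoeff, ← sq_mul_connCoeff, ← hδ] at h1
  have h3 : ((i + (l + 1) + 1 : ℕ) : ℝ≥0) ^ 2 ≤
      ((l + 2 : ℕ) : ℝ≥0) ^ 2 * ((i + 1 : ℕ) : ℝ≥0) ^ 2 := by
    rw [← mul_pow]
    have : i + (l + 1) + 1 ≤ (l + 2) * (i + 1) := by nlinarith [Nat.zero_le (l * i)]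
    gcongr
    exact_mod_cast this
  have h5 : ((i + 1 : ℕ) : ℝ≥0) ^ 2 * (connCoeff γ (i + 1) * δ) ≤ ((i + 1 : ℕ) : ℝ≥0) ^ 2 *
      (((l + 2 : ℕ) : ℝ≥0) ^ 2 * connCoeff γ (i + (l + 1) + 1)) := by
    calc _ = ((i + 1 : ℕ) : ℝ≥0) ^ 2 * connCoeff γ (i + 1) * δ := by ring
      _ ≤ _ := h1
      _ ≤ ((l + 2 : ℕ) : ℝ≥0) ^ 2 * ((i + 1 : ℕ) : ℝ≥0) ^ 2 *
          connCoeff γ (i + (l + 1) + 1) := by gcongr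
      _ = _ := by ring
  have h6 := le_of_mul_le_mul_left h5 (pos_iff_ne_zero.2 ha0)
  rw [← le_div_iff₀ (pos_iff_ne_zero.2 hδ0)] at h6
  rw [show i + 1 + (l + 1) = i + (l + 1) + 1 by omega]
  calc _ ≤ _ := h6
    _ = ((l + 2 : ℕ) : ℝ≥0) ^ 2 / δ * connCoeff γ (i + (l + 1) + 1) := by ring
    _ ≤ _ := by gcongr; exact le_max_right _ _

/-! ### A summable bound for the fragments -/

/-- The coefficients of `X ^ j / j!`, where `X` is the series with coefficients `12 / b ^ 2`. -/
noncomputable def fragmentCoeff : ℕ → ℕ → ℝ≥0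
  | 0, t => if t = 0 then 1 else 0
  | j + 1, t => (∑ b ∈ Finset.range (t + 1), 12 / (b : ℝ≥0) ^ 2 * fragmentCoeff j (t - b)) /
      ((j + 1 : ℕ) : ℝ≥0)

/-- Replacing one after another the `j` components of a fragment of size `t` by isolated vertices
and moving their other vertices to a largest component. -/
theorem connCoeff_mul_boundedForestCoeff_le (γ : BlockWeighting) {k : ℕ} (j : ℕ) :
    ∀ k' ≥ k, ∀ t, connCoeff γ k' * boundedForestCoeff γ k j t ≤
      connCoeff γ (k' + t - j) * fragmentCoeff j t := by
  induction j with
  | zero =>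
    intro k' _ t
    rw [boundedForestCoeff, fragmentCoeff]
    split_ifs with ht
    · simp [ht]
    · simp
  | succ j ih =>
    intro k' hk t
    rw [boundedForestCoeff, fragmentCoeff, mul_div_assoc', mul_div_assoc']
    gcongr ?_ / _
    rw [Finset.mul_sum, Finset.mul_sum]
    refine Finset.sum_le_sum fun b hb => ?_
    have hbt : b ≤ t := Nat.lt_succ_iff.1 (Finset.mem_range.1 hb)
    split_ifs with hbk
    swap
    · simp
    rcases Nat.eq_zero_or_pos b with rfl | hb0
    · simp [connCoeff_zero]
    have h2 := ih (k' + b - 1) (by omega) (t - b)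
    rw [show k' + b - 1 + (t - b) - j = k' + t - (j + 1) by omega] at h2
    calc _ = connCoeff γ k' * connCoeff γ b * boundedForestCoeff γ k j (t - b) := by ring
      _ ≤ 12 / (b : ℝ≥0) ^ 2 * connCoeff γ (k' + b - 1) * boundedForestCoeff γ k j (t - b) := by
          have := connCoeff_mul_le γ hb0 (hbk.trans hk)
          gcongr
      _ = 12 / (b : ℝ≥0) ^ 2 * (connCoeff γ (k' + b - 1) * boundedForestCoeff γ k j (t - b)) := by
          ring
      _ ≤ 12 / (b : ℝ≥0) ^ 2 * (connCoeff γ (k' + t - (j + 1)) * fragmentCoeff j (t - b)) := by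
          gcongr
      _ = _ := by ring

theorem sum_range_convolution_le (f g : ℕ → ℝ≥0) (M : ℕ) :
    ∑ t ∈ Finset.range M, ∑ b ∈ Finset.range (t + 1), f b * g (t - b) ≤
      (∑ b ∈ Finset.range M, f b) * ∑ t ∈ Finset.range M, g t := by
  rw [Finset.sum_comm' (t' := Finset.range M) (s' := fun b => Finset.Ico b M) (by
    intro t b
    simp only [Finset.mem_range, Finset.mem_Ico]
    omega), Finset.sum_mul]
  refine Finset.sum_le_sum fun b _ => ?_
  rw [← Finset.mul_sum, Finset.sum_Ico_eq_sum_range]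
  simp only [Nat.add_sub_cancel_left]
  gcongr
  omega

theorem exists_sum_fragmentCoeff_le :
    ∃ X : ℝ≥0, ∀ j M, ∑ t ∈ Finset.range M, fragmentCoeff j t ≤ X ^ j / (j.factorial : ℝ≥0) := by
  have hs : Summable fun b : ℕ => (12 : ℝ≥0) / (b : ℝ≥0) ^ 2 := by
    rw [← NNReal.summable_coe]
    push_cast
    simpa only [div_eq_mul_one_div (12 : ℝ)] using
      (Real.summable_one_div_nat_pow.2 (by norm_num : 1 < 2)).mul_left 12
  refine ⟨∑' b : ℕ, 12 / (b : ℝ≥0) ^ 2, fun j M => ?_⟩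
  induction j with
  | zero =>
    simp only [fragmentCoeff, Finset.sum_ite_eq']
    split_ifs <;> simp
  | succ j ih =>
    simp only [fragmentCoeff]
    rw [← Finset.sum_div, Nat.factorial_succ, Nat.cast_mul, mul_comm, ← div_div]
    gcongr
    calc _ ≤ _ := sum_range_convolution_le (fun b => 12 / (b : ℝ≥0) ^ 2) (fragmentCoeff j) M
      _ ≤ (∑' b : ℕ, 12 / (b : ℝ≥0) ^ 2) * ((∑' b : ℕ, 12 / (b : ℝ≥0) ^ 2) ^ j /
          (j.factorial : ℝ≥0)) := by
          gcongr
          exact hs.sum_le_tsum _ fun _ _ => zero_le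
      _ = _ := by rw [pow_succ']; ring

/-- The sequence `∑ⱼ Cʲ [zᵗ] Xʲ / j!` is summable, since the series of its generating function
at `1` is that of `exp (C X(1))`. -/
theorem summable_fragment (C : ℝ≥0) :
    Summable fun t => ∑ j ∈ Finset.range (t + 1), C ^ j * fragmentCoeff j t := by
  obtain ⟨X, hX⟩ := exists_sum_fragmentCoeff_le
  rw [← NNReal.summable_coe]
  refine summable_of_sum_range_le (c := Real.exp (C * X)) (fun _ => NNReal.coe_nonneg _) fun M => ?_
  have h : ∑ t ∈ Finset.range M, ∑ j ∈ Finset.range (t + 1), C ^ j * fragmentCoeff j t ≤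
      ∑ j ∈ Finset.range M, (C * X) ^ j / (j.factorial : ℝ≥0) := by
    calc _ ≤ ∑ t ∈ Finset.range M, ∑ j ∈ Finset.range M, C ^ j * fragmentCoeff j t := by
          refine Finset.sum_le_sum fun t ht => Finset.sum_le_sum_of_subset ?_
          exact Finset.range_subset_range.2 (Finset.mem_range.1 ht)
      _ = ∑ j ∈ Finset.range M, C ^ j * ∑ t ∈ Finset.range M, fragmentCoeff j t := by
          rw [Finset.sum_comm]
          simp only [Finset.mul_sum]
      _ ≤ ∑ j ∈ Finset.range M, C ^ j * (X ^ j / (j.factorial : ℝ≥0)) := by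
          gcongr with j _
          exact hX j M
      _ = _ := by simp only [mul_pow, mul_div_assoc]
  rw [← NNReal.coe_le_coe] at h
  push_cast at h ⊢
  exact h.trans (Real.sum_le_exp_of_nonneg (by positivity) M)

/-! ### Comparison with all graphs -/

/-- The coefficients of the exponential generating series of all graphs. -/
noncomputable def graphCoeff (γ : BlockWeighting) (n : ℕ) : ℝ≥0 :=
  (∑ G : SimpleGraph (Fin n), blockProd γ G) / (n.factorial : ℝ≥0)

theorem one_le_factorial_mul_boundedForestCoeff (γ : BlockWeighting) {K : ℕ} (hK : 1 ≤ K) (r : ℕ) :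
    1 ≤ (r.factorial : ℝ≥0) * boundedForestCoeff γ K r r := by
  induction r with
  | zero => simp [boundedForestCoeff]
  | succ r ih =>
    have h0 : ((r + 1 : ℕ) : ℝ≥0) ≠ 0 := by exact_mod_cast r.succ_ne_zero
    have h1 : boundedForestCoeff γ K r r ≤ ∑ b ∈ Finset.range (r + 1 + 1),
        if b ≤ K then connCoeff γ b * boundedForestCoeff γ K r (r + 1 - b) else 0 := by
      refine le_trans ?_ (Finset.single_le_sum (fun _ _ => zero_le)
        (Finset.mem_range.2 (show 1 < r + 1 + 1 by omega)))
      simp [hK, connCoeff_one]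
    rw [boundedForestCoeff, Nat.factorial_succ, Nat.cast_mul, mul_comm ((r + 1 : ℕ) : ℝ≥0),
      mul_assoc, mul_div_cancel₀ _ h0]
    exact ih.trans (by gcongr)

theorem connCoeff_le_graphCoeff (γ : BlockWeighting) {n r : ℕ} (hr : r < n) :
    connCoeff γ (n - r) ≤ ((r + 1).factorial : ℝ≥0) * graphCoeff γ n := by
  have h0 : ((r + 1 : ℕ) : ℝ≥0) ≠ 0 := by exact_mod_cast r.succ_ne_zero
  have h1 : connCoeff γ (n - r) * boundedForestCoeff γ n r r ≤ ∑ b ∈ Finset.range (n + 1),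
      if b ≤ n then connCoeff γ b * boundedForestCoeff γ n r (n - b) else 0 := by
    refine le_trans ?_ (Finset.single_le_sum (fun _ _ => zero_le)
      (Finset.mem_range.2 (show n - r < n + 1 by omega)))
    rw [if_pos (by omega), Nat.sub_sub_self hr.le]
  have h2 : boundedForestCoeff γ n (r + 1) n ≤ graphCoeff γ n := by
    have hn : (0 : ℝ≥0) < n.factorial := by exact_mod_cast n.factorial_pos
    rw [graphCoeff, le_div_iff₀ hn, mul_comm]
    have := factorial_mul_boundedForestCoeff_le (V := Fin n) γ (r + 1)
    simpa using this
  calc _ ≤ connCoeff γ (n - r) * ((r.factorial : ℝ≥0) * boundedForestCoeff γ n r r) :=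
        le_mul_of_one_le_right zero_le
          (one_le_factorial_mul_boundedForestCoeff γ (by omega) r)
    _ = (r.factorial : ℝ≥0) * (connCoeff γ (n - r) * boundedForestCoeff γ n r r) := by ring
    _ ≤ (r.factorial : ℝ≥0) * (((r + 1 : ℕ) : ℝ≥0) * boundedForestCoeff γ n (r + 1) n) := by
        rw [boundedForestCoeff, mul_div_cancel₀ _ h0]
        gcongr
    _ = ((r + 1).factorial : ℝ≥0) * boundedForestCoeff γ n (r + 1) n := by
        rw [Nat.factorial_succ]; push_cast; ring
    _ ≤ _ := by gcongr

/-- The isolated vertices are absorbed in batches by attaching blocks of a fixed size. -/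
theorem exists_connCoeff_sub_le (γ : BlockWeighting) {l : ℕ} (h : blockW γ (l + 2) ≠ 0) :
    ∃ A C : ℝ≥0, ∀ n j, j < n → connCoeff γ (n - j) ≤ A * C ^ j * graphCoeff γ n := by
  obtain ⟨C, hC1, hC⟩ := exists_connCoeff_le γ h
  refine ⟨((l + 1).factorial : ℝ≥0), C, fun n j hj => ?_⟩
  have hstep : ∀ q i, connCoeff γ (i + 1) ≤ C ^ q * connCoeff γ (i + 1 + q * (l + 1)) := by
    intro q
    induction q with
    | zero => intro i; simp
    | succ q ih =>
      intro i
      calc _ ≤ _ := ih i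
        _ ≤ C ^ q * (C * connCoeff γ (i + q * (l + 1) + 1 + (l + 1))) := by
            gcongr
            rw [show i + 1 + q * (l + 1) = i + q * (l + 1) + 1 by omega]
            exact hC _
        _ = _ := by
            rw [← mul_assoc, ← pow_succ]
            congr 2
            ring
  have hdiv := Nat.div_add_mod' j (l + 1)
  have hmod := Nat.mod_lt j (Nat.succ_pos l)
  have hle : j / (l + 1) ≤ j := Nat.div_le_self _ _
  have h1 := hstep (j / (l + 1)) (n - j - 1)
  rw [show n - j - 1 + 1 = n - j by omega,
    show n - j + j / (l + 1) * (l + 1) = n - j % (l + 1) by omega] at h1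
  calc _ ≤ _ := h1
    _ ≤ C ^ j * (((j % (l + 1) + 1).factorial : ℝ≥0) * graphCoeff γ n) := by
        gcongr
        exact connCoeff_le_graphCoeff γ (by omega)
    _ ≤ C ^ j * (((l + 1).factorial : ℝ≥0) * graphCoeff γ n) := by
        have : (j % (l + 1) + 1).factorial ≤ (l + 1).factorial := Nat.factorial_le hmod
        gcongr
    _ = _ := by ring

/-- The weight of the graphs on `n` vertices with `t` vertices outside the largest component is at
most a fraction of the total weight that is summable in `t` and does not depend on `n`. -/
theorem exists_summable_bound (γ : BlockWeighting) {l : ℕ} (h : blockW γ (l + 2) ≠ 0) :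
    ∃ f : ℕ → ℝ≥0, Summable f ∧ ∀ n k, k ≤ n →
      propW γ (fun G : SimpleGraph (Fin n) => (∀ s ∈ compSets G, s.ncard ≤ k) ∧
          ∃ s ∈ compSets G, s.ncard = k) ≤
        f (n - k) * ∑ G : SimpleGraph (Fin n), blockProd γ G := by
  obtain ⟨A, C, hAC⟩ := exists_connCoeff_sub_le γ h
  refine ⟨fun t => A * ∑ j ∈ Finset.range (t + 1), C ^ j * fragmentCoeff j t,
    (summable_fragment C).mul_left A, fun n k hk => ?_⟩
  have h1 := sum_largest_le (V := Fin n) γ k (by simpa using hk)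
  rw [Nat.card_eq_fintype_card, Fintype.card_fin] at h1
  refine h1.trans ?_
  rcases Nat.eq_zero_or_pos k with rfl | hk0
  · simp [connCoeff_zero]
  have hn : (n.factorial : ℝ≥0) ≠ 0 := by exact_mod_cast n.factorial_ne_zero
  have hg : ∑ G : SimpleGraph (Fin n), blockProd γ G = (n.factorial : ℝ≥0) * graphCoeff γ n := by
    rw [graphCoeff, mul_div_cancel₀ _ hn]
  rw [hg, mul_comm _ ((n.factorial : ℝ≥0) * _), mul_assoc]
  gcongr (n.factorial : ℝ≥0) * ?_
  simp only [Finset.mul_sum]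
  refine Finset.sum_le_sum fun j hj => ?_
  have hj : j ≤ n - k := Nat.lt_succ_iff.1 (Finset.mem_range.1 hj)
  have h2 := connCoeff_mul_boundedForestCoeff_le γ (k := k) j k le_rfl (n - k)
  rw [Nat.add_sub_cancel' hk] at h2
  calc _ ≤ _ := h2
    _ ≤ A * C ^ j * graphCoeff γ n * fragmentCoeff j (n - k) := by
        gcongr
        exact hAC n j (by omega)
    _ = _ := by ring

/-! ### The largest component -/

theorem largestComponentSize_eq_iff {V : Type} [Finite V] [Nonempty V] (G : SimpleGraph V)
    (k : ℕ) : largestComponentSize G = k ↔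
      (∀ s ∈ compSets G, s.ncard ≤ k) ∧ ∃ s ∈ compSets G, s.ncard = k := by
  have hmem : ∀ c : G.ConnectedComponent, c.supp ∈ compSets G := fun c => by simp [compSets]
  have hle : ∀ s ∈ compSets G, s.ncard ≤ largestComponentSize G := by
    intro s hs
    obtain ⟨c, rfl⟩ : ∃ c : G.ConnectedComponent, c.supp = s := by simpa [compSets] using hs
    exact le_ciSup (f := fun c : G.ConnectedComponent => c.supp.ncard)
      (Set.finite_range _).bddAbove c
  have hne : Nonempty G.ConnectedComponent := ⟨G.connectedComponentMk (Classical.arbitrary V)⟩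
  obtain ⟨c, hc⟩ := exists_eq_ciSup_of_finite (f := fun c : G.ConnectedComponent => c.supp.ncard)
  have hc : c.supp.ncard = largestComponentSize G := hc
  constructor
  · rintro rfl
    exact ⟨hle, _, hmem c, hc⟩
  · rintro ⟨h1, s, hs, rfl⟩
    exact le_antisymm (hc ▸ h1 _ (hmem c)) (hle s hs)

/-- The probability that more than `M` vertices lie outside the largest component tends to `0` as
`M` tends to infinity, uniformly in the number of vertices. -/
theorem sum_largest_tail_le (γ : BlockWeighting) {l : ℕ} (h : blockW γ (l + 2) ≠ 0) {ε : ℝ}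
    (hε : 0 < ε) : ∃ M : ℕ, ∀ n : ℕ,
      (propW γ (fun G : SimpleGraph (Fin n) => largestComponentSize G + M < n) : ℝ) ≤
        ε * ((∑ G : SimpleGraph (Fin n), blockProd γ G : ℝ≥0) : ℝ) := by
  obtain ⟨f, hf, hbound⟩ := exists_summable_bound γ h
  -- choose `M` such that the tail of the series `∑ f t` beyond `M` is at most `ε`
  obtain ⟨M, hM⟩ : ∃ M : ℕ, ∀ N, ((∑ t ∈ Finset.Ico (M + 1) N, f t : ℝ≥0) : ℝ) ≤ ε := by
    have ht := hf.tendsto_sum_tsum_nat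
    rw [← NNReal.tendsto_coe] at ht
    obtain ⟨M, hM⟩ := (ht.eventually (lt_mem_nhds (sub_lt_self _ hε))).exists
    refine ⟨M, fun N => ?_⟩
    have h1 : ∑ t ∈ Finset.range M, f t + ∑ t ∈ Finset.Ico (M + 1) N, f t ≤ ∑' t, f t := by
      rw [← Finset.sum_union]
      · exact hf.sum_le_tsum _ fun _ _ => zero_le
      · rw [Finset.disjoint_left]
        intro t ht ht'
        rw [Finset.mem_range] at ht
        rw [Finset.mem_Ico] at ht'
        omega
    have h2 : ((∑ t ∈ Finset.range M, f t : ℝ≥0) : ℝ) +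
        ((∑ t ∈ Finset.Ico (M + 1) N, f t : ℝ≥0) : ℝ) ≤ ((∑' t, f t : ℝ≥0) : ℝ) := by
      exact_mod_cast h1
    linarith
  refine ⟨M, fun n => ?_⟩
  rcases Nat.eq_zero_or_pos n with rfl | hn
  · simp only [propW, Nat.not_lt_zero, Finset.filter_false, Finset.sum_empty, NNReal.coe_zero]
    positivity
  have hne : Nonempty (Fin n) := ⟨⟨0, hn⟩⟩
  have h1 : propW γ (fun G : SimpleGraph (Fin n) => largestComponentSize G + M < n) ≤
      (∑ t ∈ Finset.Ico (M + 1) (n + 1), f t) * ∑ G : SimpleGraph (Fin n), blockProd γ G := by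
    calc _ = ∑ k ∈ Finset.range (n - M),
          propW γ (fun G : SimpleGraph (Fin n) => largestComponentSize G = k) := by
          rw [propW_eq_sum, ← Finset.sum_fiberwise_of_maps_to
            (g := fun G : SimpleGraph (Fin n) => largestComponentSize G)
            (t := Finset.range (n - M))]
          · refine Finset.sum_congr rfl fun k hk => ?_
            rw [Finset.filter_filter, propW_eq_sum]
            refine Finset.sum_congr (Finset.filter_congr fun G _ => ?_) fun _ _ => rfl
            have := Finset.mem_range.1 hk
            exact ⟨fun h => h.2, fun h => ⟨by omega, h⟩⟩
          · intro G hG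
            have := (Finset.mem_filter.1 hG).2
            rw [Finset.mem_range]
            omega
      _ ≤ ∑ k ∈ Finset.range (n - M), f (n - k) * ∑ G : SimpleGraph (Fin n), blockProd γ G := by
          refine Finset.sum_le_sum fun k hk => ?_
          have := Finset.mem_range.1 hk
          simp only [largestComponentSize_eq_iff]
          exact hbound n k (by omega)
      _ = _ := by
          rw [← Finset.sum_mul]
          congr 1
          refine Finset.sum_bij (fun k _ => n - k) ?_ ?_ ?_ fun _ _ => rfl
          · intro k hk
            rw [Finset.mem_range] at hk
            rw [Finset.mem_Ico]
            omega
          · intro k hk k' hk' h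
            rw [Finset.mem_range] at hk hk'
            omega
          · intro t ht
            rw [Finset.mem_Ico] at ht
            exact ⟨n - t, by rw [Finset.mem_range]; omega, by omega⟩
  calc _ ≤ (((∑ t ∈ Finset.Ico (M + 1) (n + 1), f t) *
        ∑ G : SimpleGraph (Fin n), blockProd γ G : ℝ≥0) : ℝ) := NNReal.coe_le_coe.2 h1
    _ ≤ _ := by
        rw [NNReal.coe_mul]
        gcongr
        exact hM _

/-- Given the vertex set of the selected component and the graph outside of it, the selected
component is an arbitrary connected graph on its vertex set: which component gets selected does
not depend on the edges inside. -/
theorem sum_selected_eq (γ : BlockWeighting) {n : ℕ}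
    {L : (G : SimpleGraph (Fin n)) → G.ConnectedComponent}
    (hL : ∀ G H : SimpleGraph (Fin n), G.Reachable = H.Reachable → (L G).supp = (L H).supp)
    (Q : (S : Set (Fin n)) → SimpleGraph S → Prop) :
    propW γ (fun G : SimpleGraph (Fin n) => Q (L G).supp (G.induce (L G).supp)) =
      ∑ S : Set (Fin n), propW γ (fun C : SimpleGraph S => C.Connected ∧ Q S C) *
        propW γ fun D : SimpleGraph (Sᶜ : Set (Fin n)) =>
          ∃ C : SimpleGraph S, C.Connected ∧ (L (glue S C D)).supp = S := by
  have h1 : propW γ (fun G : SimpleGraph (Fin n) => Q (L G).supp (G.induce (L G).supp)) =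
      ∑ G : SimpleGraph (Fin n), ∑ s ∈ compSets G,
        if (L G).supp = s ∧ Q s (G.induce s) then blockProd γ G else 0 := by
    rw [propW, Finset.sum_filter]
    refine Finset.sum_congr rfl fun G _ => ?_
    rw [Finset.sum_eq_single_of_mem (L G).supp (by simp [compSets])]
    · simp
    · intro s _ hs
      rw [if_neg fun h => hs h.1.symm]
  rw [h1, sum_compSets_eq]
  refine Finset.sum_congr rfl fun S _ => ?_
  rw [propW_eq_sum, propW, Finset.sum_mul_sum, ← Finset.filter_filter,
    Finset.sum_filter (p := fun C => Q S C)]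
  refine Finset.sum_congr (by ext C; simp) fun C hC => ?_
  have hC : C.Connected := by simpa using hC
  have hval : ∀ D : SimpleGraph (Sᶜ : Set (Fin n)),
      (∃ C : SimpleGraph S, C.Connected ∧ (L (glue S C D)).supp = S) ↔
        (L (glue S C D)).supp = S := by
    intro D
    refine ⟨?_, fun h => ⟨C, hC, h⟩⟩
    rintro ⟨C', hC', h⟩
    rw [← hL _ _ (?_ : (glue S C' D).Reachable = (glue S C D).Reachable), h]
    funext a b
    rw [reachable_glue_iff hC, reachable_glue_iff hC']
  rw [Finset.sum_filter]
  simp only [hval, induce_glue, blockProd_glue]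
  split_ifs with hQ
  · exact Finset.sum_congr rfl fun D _ => by simp [hQ]
  · simp [hQ]

theorem sum_connected_isoClass (γ : BlockWeighting) {V : Type} [Finite V] {k : ℕ}
    (hk : Nat.card V = k) (H : SimpleGraph (Fin k)) :
    propW γ (fun C : SimpleGraph V => C.Connected ∧ Nonempty (C ≃g H)) =
      propW γ fun C : SimpleGraph (Fin k) => C.Connected ∧ Nonempty (C ≃g H) := by
  let e : Fin k ≃ V := (Finite.equivFinOfCardEq hk).symm
  symm
  have hiso : ∀ C : SimpleGraph (Fin k), Nonempty (C ≃g C.map e.toEmbedding) :=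
    fun C => ⟨Iso.map e C⟩
  refine Finset.sum_bij (fun C _ => C.map e.toEmbedding) ?_ ?_ ?_ ?_
  · intro C hC
    obtain ⟨hc, ⟨i⟩⟩ : C.Connected ∧ Nonempty (C ≃g H) := by simpa using hC
    obtain ⟨j⟩ := hiso C
    simpa using ⟨j.connected_iff.1 hc, ⟨j.symm.trans i⟩⟩
  · exact fun C _ D _ h => SimpleGraph.map_injective e.toEmbedding h
  · intro D hD
    obtain ⟨hc, ⟨i⟩⟩ : D.Connected ∧ Nonempty (D ≃g H) := by simpa using hD
    have hmap : (D.comap e.toEmbedding).map e.toEmbedding = D := by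
      ext a b
      rw [SimpleGraph.map_adj]
      constructor
      · rintro ⟨u, v, h, rfl, rfl⟩
        exact h
      · exact fun h => ⟨e.symm a, e.symm b, by simpa using h, by simp, by simp⟩
    obtain ⟨j⟩ := hiso (D.comap e.toEmbedding)
    rw [hmap] at j
    exact ⟨_, by simpa using ⟨j.connected_iff.2 hc, ⟨j.trans i⟩⟩, hmap⟩
  · exact fun C _ => (blockProd_map γ e.toEmbedding C).symm

/-! ### Probabilities -/

theorem inventory_indicator_graphW (γ : BlockWeighting) (n : ℕ)
    (P : SimpleGraph (Fin n) → Prop) :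
    inventory (Set.indicator {G | P G} (graphW γ n)) = propW γ P := by
  rw [inventory, finsum_eq_sum_of_fintype, propW, Finset.sum_filter]
  refine Finset.sum_congr rfl fun G _ => ?_
  rw [Set.indicator_apply, graphW, graphWeight_eq_blockProd]
  rfl

theorem inventory_graphW (γ : BlockWeighting) (n : ℕ) :
    inventory (graphW γ n) = ∑ G : SimpleGraph (Fin n), blockProd γ G := by
  rw [inventory, finsum_eq_sum_of_fintype]
  exact Finset.sum_congr rfl fun G _ => graphWeight_eq_blockProd γ G

theorem inventory_indicator_connW (γ : BlockWeighting) (k : ℕ)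
    (P : SimpleGraph (Fin k) → Prop) :
    inventory (Set.indicator {C : ConnGraph k | P C.1} (connW γ k)) =
      propW γ fun C => C.Connected ∧ P C := by
  have := Fintype.ofFinite (ConnGraph k)
  rw [inventory, finsum_eq_sum_of_fintype, propW_eq_sum, ← Finset.filter_filter, Finset.sum_filter]
  symm
  refine Finset.sum_bij (fun C hC => ⟨C, (Finset.mem_filter.1 hC).2⟩) (by simp) ?_ ?_ ?_
  · exact fun C _ D _ h => Subtype.mk.inj h
  · exact fun C _ => ⟨C.1, by simp [C.2], rfl⟩
  · intro C hC
    rw [Set.indicator_apply, connW, connWeight_eq_blockProd]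
    rfl

theorem inventory_connW (γ : BlockWeighting) (k : ℕ) :
    inventory (connW γ k) = connTotal γ (Fin k) := by
  have h := inventory_indicator_connW γ k fun _ => True
  simp only [and_true, Set.ofPred_true, Set.indicator_univ] at h
  exact h

theorem inventory_graphW_ne_zero (γ : BlockWeighting) (n : ℕ) :
    inventory (graphW γ n) ≠ 0 := by
  rw [inventory_graphW]
  -- the graph without edges has weight `1`
  refine ne_of_gt (lt_of_lt_of_le zero_lt_one
    (le_trans ?_ (Finset.single_le_sum (fun _ _ => zero_le) (Finset.mem_univ ⊥))))
  rw [blockProd, blocks_bot, Finset.prod_empty]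

theorem exists_blockW_ne_zero (γ : BlockWeighting)
    (hγ : ∃ (m : ℕ) (B : SimpleGraph (Fin m)), IsBlockGraph B ∧ γ.weight (Fin m) B ≠ 0) :
    ∃ l, blockW γ (l + 2) ≠ 0 := by
  obtain ⟨m, B, hB, hw⟩ := hγ
  have hm : 2 ≤ m := by
    rcases hB with h | h
    · have := h.1; rw [Nat.card_eq_fintype_card, Fintype.card_fin] at this; omega
    · have := h.1; rw [Nat.card_eq_fintype_card, Fintype.card_fin] at this; omega
  obtain ⟨l, rfl⟩ := Nat.exists_eq_add_of_le' hm
  refine ⟨l, ne_of_gt (lt_of_lt_of_le (pos_iff_ne_zero.2 hw) ?_)⟩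
  exact Finset.single_le_sum (f := fun B => γ.weight (Fin (l + 2)) B) (fun _ _ => zero_le)
    (by simpa using hB)

/-- The common factor `N` is the total weight of the graphs that can surround a selected component
with `k` vertices. -/
theorem selected_weights (γ : BlockWeighting) {n : ℕ}
    {L : (G : SimpleGraph (Fin n)) → G.ConnectedComponent} (hL : SelectsLargestComponent L)
    (k : ℕ) : ∃ N : ℝ≥0,
      propW γ (fun G : SimpleGraph (Fin n) => largestComponentSize G = k) =
        connTotal γ (Fin k) * N ∧
      ∀ H : SimpleGraph (Fin k),
        propW γ (fun G : SimpleGraph (Fin n) => Nonempty ((L G).toSimpleGraph ≃g H)) =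
          propW γ (fun C : SimpleGraph (Fin k) => C.Connected ∧ Nonempty (C ≃g H)) * N := by
  refine ⟨∑ S : Set (Fin n) with S.ncard = k, propW γ fun D : SimpleGraph (Sᶜ : Set (Fin n)) =>
          ∃ C : SimpleGraph S, C.Connected ∧ (L (glue S C D)).supp = S, ?_, ?_⟩
  · have h1 := sum_selected_eq γ hL.2 fun S _ => S.ncard = k
    simp only [hL.1] at h1
    rw [h1, Finset.mul_sum, Finset.sum_filter]
    refine Finset.sum_congr rfl fun S _ => ?_
    split_ifs with hS
    · congr 1
      simp only [hS, and_true]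
      change connTotal γ S = _
      rw [connTotal_eq, connTotal_eq, Nat.card_coe_set_eq, hS]
      simp
    · simp [hS, propW]
  · intro H
    have h1 := sum_selected_eq γ hL.2 fun S C => Nonempty (C ≃g H)
    refine h1.trans ?_
    rw [Finset.mul_sum, Finset.sum_filter]
    refine Finset.sum_congr rfl fun S _ => ?_
    split_ifs with hS
    · rw [sum_connected_isoClass γ (by rw [Nat.card_coe_set_eq, hS]) H]
    · rw [propW_eq_sum, Finset.filter_false_of_mem, Finset.sum_empty, zero_mul]
      rintro C - ⟨-, ⟨i⟩⟩
      have := Nat.card_congr i.toEquiv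
      rw [Nat.card_coe_set_eq, Nat.card_eq_fintype_card, Fintype.card_fin] at this
      exact hS this

theorem inventory_connW_ne_zero_of_prob_pos (γ : BlockWeighting) {n k : ℕ} (hn : 1 ≤ n)
    (h : 0 < prob (graphW γ n) {G | largestComponentSize G = k}) :
    inventory (connW γ k) ≠ 0 := by
  have : Nonempty (Fin n) := ⟨⟨0, hn⟩⟩
  intro h0
  have h1 : connCoeff γ k = 0 := by
    rw [connCoeff, ← inventory_connW, h0, zero_div]
  have hkn : k ≤ n := by
    by_contra hkn
    have h2 : ∀ G : SimpleGraph (Fin n), largestComponentSize G ≠ k := by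
      intro G hG
      obtain ⟨-, s, -, hs⟩ := (largestComponentSize_eq_iff G k).1 hG
      have := Set.ncard_le_card s
      rw [Nat.card_eq_fintype_card, Fintype.card_fin] at this
      omega
    simp [prob, h2, inventory] at h
  have h2 := sum_largest_le (V := Fin n) γ k (by simpa using hkn)
  rw [h1, zero_mul, mul_zero, nonpos_iff_eq_zero] at h2
  rw [prob, inventory_indicator_graphW] at h
  simp only [largestComponentSize_eq_iff] at h
  rw [h2] at h
  simp at h

end BlockWeighted

theorem mainTheorem10 (γ : BlockWeighted.BlockWeighting)
    (hγ : ∃ (m : ℕ) (B : SimpleGraph (Fin m)),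
      BlockWeighted.IsBlockGraph B ∧ γ.weight (Fin m) B ≠ 0) :
    -- the random graph on `n` vertices is well defined
    (∀ n : ℕ, BlockWeighted.inventory (BlockWeighted.graphW γ n) ≠ 0) ∧
    -- its largest component has size `n + O_p(1)`
    (∀ ε : ℝ, 0 < ε → ∃ M : ℕ, ∀ n : ℕ,
      BlockWeighted.prob (BlockWeighted.graphW γ n)
        {G | BlockWeighted.largestComponentSize G + M < n} ≤ ε) ∧
    -- every size that the largest component attains with positive probability is the size of
    -- some connected graph with positive weight
    (∀ n k : ℕ, 1 ≤ n →
      0 < BlockWeighted.prob (BlockWeighted.graphW γ n)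
        {G | BlockWeighted.largestComponentSize G = k} →
      BlockWeighted.inventory (BlockWeighted.connW γ k) ≠ 0) ∧
    -- the unlabelled largest component is a mixture of unlabelled random connected graphs
    (∀ n : ℕ, 1 ≤ n →
      ∀ L : (G : SimpleGraph (Fin n)) → G.ConnectedComponent,
        BlockWeighted.SelectsLargestComponent L →
        ∀ (k : ℕ) (H : SimpleGraph (Fin k)),
          BlockWeighted.prob (BlockWeighted.graphW γ n)
              {G | Nonempty ((L G).toSimpleGraph ≃g H)} =
            BlockWeighted.prob (BlockWeighted.graphW γ n)
                {G | BlockWeighted.largestComponentSize G = k} *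
              BlockWeighted.prob (BlockWeighted.connW γ k)
                {C | Nonempty (C.1 ≃g H)}) := by
  open BlockWeighted in
  refine ⟨inventory_graphW_ne_zero γ, ?_, fun n k => inventory_connW_ne_zero_of_prob_pos γ, ?_⟩
  · intro ε hε
    obtain ⟨l, hl⟩ := exists_blockW_ne_zero γ hγ
    obtain ⟨M, hM⟩ := sum_largest_tail_le γ hl hε
    refine ⟨M, fun n => ?_⟩
    have hg : (0 : ℝ) < (inventory (graphW γ n) : ℝ) :=
      NNReal.coe_pos.2 (pos_iff_ne_zero.2 (inventory_graphW_ne_zero γ n))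
    rw [prob, NNReal.coe_div, div_le_iff₀ hg, inventory_indicator_graphW, inventory_graphW]
    exact hM n
  · intro n _ L hL k H
    obtain ⟨N, h1, h2⟩ := selected_weights γ hL k
    have hE := inventory_indicator_connW γ k fun C => Nonempty (C ≃g H)
    rw [prob, prob, prob, inventory_indicator_graphW, inventory_indicator_graphW, hE, h1, h2,
      inventory_connW, ← NNReal.coe_mul]
    congr 1
    by_cases h0 : connTotal γ (Fin k) = 0
    · have h3 : propW γ (fun C : SimpleGraph (Fin k) => C.Connected ∧ Nonempty (C ≃g H)) = 0 := by
        refine nonpos_iff_eq_zero.1 (le_of_le_of_eq ?_ h0)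
        rw [connTotal, propW, propW]
        refine Finset.sum_le_sum_of_subset fun C hC => ?_
        simp only [Finset.mem_filter, Finset.mem_univ, true_and] at hC ⊢
        exact hC.1
      rw [h3, zero_mul, zero_div, zero_div, mul_zero]
    · field_simp
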